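/- Let $1\le k_1\le k_2$, $n=k_1+k_2$, let $\mathsf N\in\mathfrak{gl}_n(\mathbb R)$ be the nilpotent matrix in Jordan normal form (ones on the superdiagonal) with a first block of size $k_1$ and a second block of size $k_2$, and let $\mathsf M=\mathsf N^{T}$. For $A\in\mathfrak{gl}_n(\mathbb R)$ let $S_A$ be the substitution operator $(S_A\varphi)(x)=\varphi(Ax)$ on polynomials in $x_1,\dots,x_n$ (and on polynomial maps $\mathbb R^n\to\mathbb R^n$). For a nilpotent $\mathbf n=P^{-1}\mathsf N P$ with $P\in GL_n(\mathbb R)$, put $\mathbf m=P^{-1}\mathsf M P$, let $p$ be the least integer with $\mathbf n^p=0$, and set $$\bar{\mathbf m}=\sum_{i=1}^{p-1}\sum_{l=0}^{i-1}\mathbf n^{l}\mathbf m^{i}\mathbf n^{i-l-1},\qquad S_{\bar{\mathbf m}}=\sum_{i=1}^{p-1}\sum_{l=0}^{i-1}S_{\mathbf n}^{l}S_{\mathbf m}^{i}S_{\mathbf n}^{i-l-1},\qquad S_{\bar{\mathbf h}}=\sum_{i=1}^{p-1}[S_{\mathbf m}^i,S_{\mathbf n}^i],$$ and $\Delta_{\bar{\mathbf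 m}}\varphi=\bar{\mathbf m}\varphi-S_{\bar{\mathbf m}}\varphi$ on polynomial maps $\varphi:\mathbb R^n\to\mathbb R^n$. (So $S_{\bar{\mathbf m}}$ is the bar of $S_{\mathbf m}$, not the substitution by $\bar{\mathbf m}$.) For $P=I$ write $\bar{\mathsf M},S_{\bar{\mathsf M}},S_{\bar{\mathsf H}}$. (1) On the space of polynomials without constant term, $$\begin{aligned}\ker S_{\bar{\mathsf M}}=&\bigoplus_{i=0}^{k_1-2}x_1x_{k_1-i}\,\mathbb R[x_1,\dots,x_{k_1-i},x_{k_1+1},\dots,x_{n-i}]\\ &\oplus\bigoplus_{i=0}^{k_1-2}x_1x_{n-i}\,\mathbb R[x_1,\dots,x_{k_1-i-1},x_{k_1+1},\dots,x_{n-i}]\\ &\oplus x_1\,\mathbb R[x_1,x_{k_1+1},\dots,x_{k_2+1}]\\ &\oplus\bigoplus_{i=0}^{k_1-2}x_{k_1-i}x_{k_1+1}\,\mathbb R[x_2,\dots,x_{k_1-i},x_{k_1+1},\dots,x_{n-i}]\\ &\oplus\bigoplus_{i=0}^{k_1-3}x_{k_1+1}x_{n-i}\,\mathbb R[x_2,\dots,x_{k_1-i-1},x_{k_1+1},\dots,x_{n-i}]\\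 &\oplus\bigoplus_{i=\max(k_1-2,0)}^{k_2-2}x_{k_1+1}x_{n-i}\,\mathbb R[x_{k_1+1},\dots,x_{n-i}]\\ &\oplus x_{k_1+1}\,\mathbb R[x_{k_1+1}].\end{aligned}$$ Moreover every summand indexed by $i$ consists of eigenvectors (and $0$) of $S_{\bar{\mathsf H}}$ with eigenvalue $i$, the summand $x_1\mathbb R[x_1,x_{k_1+1},\dots,x_{k_2+1}]$ has eigenvalue $k_1-1$, and $x_{k_1+1}\mathbb R[x_{k_1+1}]$ has eigenvalue $k_2-1$. (2) For every $P\in GL_n(\mathbb R)$, let $G(t)$ be the formal power series whose coefficient of $t^d$ is, for $d\ge1$, the dimension of the kernel of $\Delta_{\bar{\mathbf m}}$ on the homogeneous polynomial maps $\mathbb R^n\to\mathbb R^n$ of degree $d$, and whose constant term is, by convention, $\dim\ker\bar{\mathbf m}$ (constants do not belong to the space on which $\Delta_{\bar{\mathbf m}}$ is considered). Then $$G(t)=\frac{2}{(1-t)^{k_1+k_2}}-\sum_{i=1}^{k_2-k_1}\frac{t}{(1-t)^i}.$$ (3) Consequently $G(t)$ is the case $b=2$, $(n_1,n_2)=(k_1,k_2)$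 of the series $$\frac{b}{(1-t)^{n_1+\dots+n_b}}-\sum_{n_j<n_i}\sum_{k=1}^{n_i-n_j}\frac{t}{(1-t)^k}$$ conjectured for a nilpotent with $b$ Jordan blocks of sizes $n_1,\dots,n_b$ (the outer sum runs over the pairs of blocks $(j,i)$ with $n_j<n_i$). -/

import Mathlib

open scoped PowerSeries

noncomputable section

namespace NilpotentMap

/-! ### The triple attached to a pair `(N, M)` -/

/-- `∑_{i=1}^{p-1} ∑_{l=0}^{i-1} N^l M^i N^{i-l-1}`, the operator `M̄`. -/
def barM {R : Type*} [Ring R] (p : ℕ) (N M : R) : R :=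
  ∑ i ∈ Finset.Icc 1 (p - 1), ∑ l ∈ Finset.range i, N ^ l * M ^ i * N ^ (i - l - 1)

/-- `∑_{i=1}^{p-1} [M^i, N^i]`, the operator `H̄`. -/
def barH {R : Type*} [Ring R] (p : ℕ) (N M : R) : R :=
  ∑ i ∈ Finset.Icc 1 (p - 1), (M ^ i * N ^ i - N ^ i * M ^ i)

/-! ### Operators on polynomials and on polynomial maps -/

/-- The substitution operator `S_A` on polynomials, `(S_A f)(x) = f (A x)`. -/
def subst {n : ℕ} (A : Matrix (Fin n) (Fin n) ℝ) :
    Module.End ℝ (MvPolynomial (Fin n) ℝ) :=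
  (MvPolynomial.aeval
    (fun i => ∑ j, MvPolynomial.C (A i j) * MvPolynomial.X j)).toLinearMap

/-- The substitution operator on polynomial maps `φ : ℝⁿ → ℝⁿ`, `(S_A φ)(x) = φ (A x)`. -/
def substV {n : ℕ} (A : Matrix (Fin n) (Fin n) ℝ) :
    Module.End ℝ (Fin n → MvPolynomial (Fin n) ℝ) :=
  (subst A).compLeft (Fin n)

/-- The multiplication operator on polynomial maps, `φ ↦ A φ(x)`. -/
def multV {n : ℕ} (A : Matrix (Fin n) (Fin n) ℝ) :
    Module.End ℝ (Fin n → MvPolynomial (Fin n) ℝ) :=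
  LinearMap.pi fun i => ∑ j, A i j • LinearMap.proj j

/-- `S_{M̄}` on polynomials: the bar construction applied to `S_N, S_M`
(not the substitution by the matrix `M̄`), with `p` the nilpotency index of `N`. -/
def substBarM {n : ℕ} (N M : Matrix (Fin n) (Fin n) ℝ) :
    Module.End ℝ (MvPolynomial (Fin n) ℝ) :=
  barM (nilpotencyClass N) (subst N) (subst M)

/-- `S_{H̄}` on polynomials. -/
def substBarH {n : ℕ} (N M : Matrix (Fin n) (Fin n) ℝ) :
    Module.End ℝ (MvPolynomial (Fin n) ℝ) :=
  barH (nilpotencyClass N) (subst N) (subst M)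

/-- `Δ_{M̄} = M̄ - S_{M̄}` on polynomial maps. -/
def deltaBarM {n : ℕ} (N M : Matrix (Fin n) (Fin n) ℝ) :
    Module.End ℝ (Fin n → MvPolynomial (Fin n) ℝ) :=
  barM (nilpotencyClass N) (multV N) (multV M) -
    barM (nilpotencyClass N) (substV N) (substV M)

/-- The polynomials without constant term. -/
def noConst (n : ℕ) : Submodule ℝ (MvPolynomial (Fin n) ℝ) :=
  LinearMap.ker (MvPolynomial.lcoeff ℝ (0 : Fin n →₀ ℕ))

/-- The polynomial maps `ℝⁿ → ℝⁿ` that are homogeneous of degree `d`. -/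
def homogV (n d : ℕ) : Submodule ℝ (Fin n → MvPolynomial (Fin n) ℝ) :=
  Submodule.pi Set.univ fun _ => MvPolynomial.homogeneousSubmodule (Fin n) ℝ d

/-- The generating function of `ker Δ_{M̄}`. For `d ≥ 1` the coefficient of `t^d` is the
dimension of the kernel on homogeneous maps of degree `d`. On the constant maps, which do not
belong to the space on which the triple acts, the constant term counts the kernel of `M̄`. -/
def kerGenFun {n : ℕ} (N M : Matrix (Fin n) (Fin n) ℝ) : ℚ⟦X⟧ :=
  PowerSeries.mk fun d =>
    if d = 0 then
      (Module.finrank ℝ (LinearMap.ker (barM (nilpotencyClass N) N M).mulVecLin) : ℚ)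
    else
      (Module.finrank ℝ (LinearMap.ker (deltaBarM N M) ⊓ homogV n d : Submodule ℝ _) : ℚ)

/-! ### Two Jordan blocks -/

/-- The nilpotent matrix in Jordan normal form (ones on the superdiagonal) with a first block of
size `k₁` and a second one of size `k₂`. -/
def jordanTwo (k₁ k₂ : ℕ) : Matrix (Fin (k₁ + k₂)) (Fin (k₁ + k₂)) ℝ :=
  fun i j => if (i : ℕ) + 1 = (j : ℕ) ∧ (j : ℕ) ≠ k₁ then 1 else 0

/-- The variable `x_j`, numbered from `1` to `n` (and `0` for other `j`). -/
def x (n j : ℕ) : MvPolynomial (Fin n) ℝ :=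
  if h : 1 ≤ j ∧ j ≤ n then MvPolynomial.X ⟨j - 1, by omega⟩ else 0

/-- The subspace `f ℝ[x_a, …, x_b, x_c, …, x_d]`. -/
def piece (n : ℕ) (f : MvPolynomial (Fin n) ℝ) (a b c d : ℕ) :
    Submodule ℝ (MvPolynomial (Fin n) ℝ) :=
  (Subalgebra.toSubmodule (Algebra.adjoin ℝ
    {g | ∃ j, (j ∈ Set.Icc a b ∨ j ∈ Set.Icc c d) ∧ j ∈ Set.Icc 1 n ∧ g = x n j})).map
    (LinearMap.mulLeft ℝ f)

/-- The index set of the direct sum decomposition of `ker S_{M̄}`. -/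
inductive PieceIdx (k₁ k₂ : ℕ) : Type
  | A (i : ℕ) (hi : i + 2 ≤ k₁)
  | B (i : ℕ) (hi : i + 2 ≤ k₁)
  | C
  | D (i : ℕ) (hi : i + 2 ≤ k₁)
  | E (i : ℕ) (hi : i + 3 ≤ k₁)
  | F (i : ℕ) (hi : k₁ ≤ i + 2) (hi' : i + 2 ≤ k₂)
  | G

/-- The summands of the decomposition. -/
def summand (k₁ k₂ : ℕ) : PieceIdx k₁ k₂ → Submodule ℝ (MvPolynomial (Fin (k₁ + k₂)) ℝ)
  | .A i _ => piece _ (x _ 1 * x _ (k₁ - i)) 1 (k₁ - i) (k₁ + 1) (k₁ + k₂ - i)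
  | .B i _ => piece _ (x _ 1 * x _ (k₁ + k₂ - i)) 1 (k₁ - i - 1) (k₁ + 1) (k₁ + k₂ - i)
  | .C => piece _ (x _ 1) 1 1 (k₁ + 1) (k₂ + 1)
  | .D i _ => piece _ (x _ (k₁ - i) * x _ (k₁ + 1)) 2 (k₁ - i) (k₁ + 1) (k₁ + k₂ - i)
  | .E i _ => piece _ (x _ (k₁ + 1) * x _ (k₁ + k₂ - i)) 2 (k₁ - i - 1) (k₁ + 1) (k₁ + k₂ - i)
  | .F i _ _ =>
      piece _ (x _ (k₁ + 1) * x _ (k₁ + k₂ - i)) (k₁ + 1) (k₁ + k₂ - i) (k₁ + 1) (k₁ + k₂ - i)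
  | .G => piece _ (x _ (k₁ + 1)) (k₁ + 1) (k₁ + 1) (k₁ + 1) (k₁ + 1)

/-- The exponent of `u` in front of each summand. -/
def weight (k₁ k₂ : ℕ) : PieceIdx k₁ k₂ → ℕ
  | .A i _ => i
  | .B i _ => i
  | .C => k₁ - 1
  | .D i _ => i
  | .E i _ => i
  | .F i _ _ => i
  | .G => k₂ - 1

/-- The series `b / (1 - t)^n - ∑_{ν_j < ν_i} ∑_{k=1}^{ν_i - ν_j} t / (1 - t)^k`, where
`n = ∑ ν_i`, conjectured for a nilpotent with `b` Jordan blocks of sizes `ν_1, …, ν_b`. -/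
def conjecturedSeries {b : ℕ} (ν : Fin b → ℕ) : ℚ⟦X⟧ :=
  (b : ℚ⟦X⟧) * ((1 - PowerSeries.X)⁻¹) ^ (∑ i, ν i) -
    ∑ q : Fin b × Fin b with ν q.1 < ν q.2,
      ∑ k ∈ Finset.Icc 1 (ν q.2 - ν q.1), PowerSeries.X * ((1 - PowerSeries.X)⁻¹) ^ k

end NilpotentMap

end

/-!
`S_N` and `S_M` map a nonconstant monomial to a monomial or to zero: `S_N` raises the index of every
variable by one and kills a monomial containing the last variable of a block, `S_M` is the inverse
partial shift. The nonconstant monomials are thus divided into strings, and so are the unit vectors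
of `ℝⁿ` under `N` and `M`. On a string the bar construction yields the lowering operator and the
weight operator of an irreducible representation of `𝔰𝔩₂` (`IsShiftPair.barM_apply`,
`IsShiftPair.barH_apply`). All strings have length at most `k₂`, the nilpotency index of `N`.

Hence `ker S_{M̄}` is spanned by the monomials at which a string starts, those containing the first
variable of a block, and the eigenvalue of `S_{H̄}` at such a monomial is the least distance of
one of its variables to the end of its block. Each summand is the span of a set of monomials, and
the summands sort the initial monomials by this distance and by the variables that occur
(`PieceIdx.exists_contains`, `PieceIdx.Contains.unique`).

For `Δ_{M̄}` put `Y = S_{M̄}`. The equation `Δ_{M̄} φ = 0` is a recursion expressing, inside each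
block, a component of `φ` as a nonzero multiple of `Y` applied to the next one. A solution is
determined by the last components `f`, `g` of the two blocks, and these are subject only to
`Y ^ k₁ f = 0` and `Y ^ k₂ g = 0` (`finrank_recursion`). In degree `d ≥ 1` the kernel of `Y ^ k` is
spanned by the monomials not made up of variables at distance at least `k` from the beginning of
their block. There are `k₂ - k₁` such variables for `k = k₁` and none for `k = k₂`, so the dimension
is twice the number of monomials of degree `d` in `k₁ + k₂` variables minus the number of those in
`k₂ - k₁` variables. The sum in the generating function telescopes to the same coefficients.
Conjugation by `P` is undone by the change of coordinates `φ ↦ P φ(P⁻¹ x)` (`kerGenFun_conj`).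
-/

noncomputable section

namespace NilpotentMap

/-! ### Partial shifts and the bar construction -/

/-- `U` and `D` act on the family `b` as mutually inverse partial shifts: `U` moves `b i` to
`b (g i)` and can be applied exactly `r i` times before the result vanishes, `D` moves `b i` to
`b (g' i)` and can be applied exactly `s i` times. The family thus falls into strings, and
`r i + s i + 1` is the length of the string through `i`. -/
structure IsShiftPair {ι E : Type*} [AddCommGroup E] [Module ℝ E] (U D : Module.End ℝ E)
    (b : ι → E) (g g' : ι → ι) (r s : ι → ℕ) : Prop where
  up : ∀ i, U (b i) = if 0 < r i then b (g i) else 0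
  down : ∀ i, D (b i) = if 0 < s i then b (g' i) else 0
  down_up : ∀ i, 0 < r i → g' (g i) = i ∧ r (g i) = r i - 1 ∧ s (g i) = s i + 1
  up_down : ∀ i, 0 < s i → g (g' i) = i ∧ s (g' i) = s i - 1 ∧ r (g' i) = r i + 1

namespace IsShiftPair

variable {ι E : Type*} [AddCommGroup E] [Module ℝ E] {U D : Module.End ℝ E} {b : ι → E}
  {g g' : ι → ι} {r s : ι → ℕ}

theorem symm (h : IsShiftPair U D b g g' r s) : IsShiftPair D U b g' g s r :=
  ⟨h.down, h.up, h.up_down, h.down_up⟩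

theorem up_pow (h : IsShiftPair U D b g g' r s) (m : ℕ) (i : ι) :
    (U ^ m) (b i) = if m ≤ r i then b (g^[m] i) else 0 := by
  induction m generalizing i with
  | zero => simp
  | succ m ih =>
    rw [pow_succ, Module.End.mul_apply, h.up]
    by_cases hr : 0 < r i
    · rw [if_pos hr, ih, (h.down_up i hr).2.1, Function.iterate_succ_apply]
      congr 1
      exact propext (by omega)
    · rw [if_neg hr, map_zero, if_neg (by omega)]

theorem down_pow (h : IsShiftPair U D b g g' r s) (m : ℕ) (i : ι) :
    (D ^ m) (b i) = if m ≤ s i then b (g'^[m] i) else 0 :=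
  h.symm.up_pow m i

theorem iterate_up_down (h : IsShiftPair U D b g g' r s) {m : ℕ} {i : ι} (hm : m ≤ s i) :
    g^[m] (g'^[m] i) = i := by
  induction m generalizing i with
  | zero => rfl
  | succ m ih =>
    have h1 := h.up_down i (by omega)
    rw [Function.iterate_succ_apply' g, Function.iterate_succ_apply g', ih (by omega), h1.1]

theorem down_pow_up_pow (h : IsShiftPair U D b g g' r s) {m : ℕ} {i : ι} (hm : m ≤ r i) :
    (D ^ m) ((U ^ m) (b i)) = b i := by
  induction m generalizing i with
  | zero => simp
  | succ m ih =>
    have h1 := h.down_up i (by omega)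
    rw [pow_succ U, Module.End.mul_apply, h.up, if_pos (by omega), pow_succ' D,
      Module.End.mul_apply, ih (by omega), h.down, if_pos (by omega), h1.1]

theorem barM_term (h : IsShiftPair U D b g g' r s) (l m : ℕ) (i : ι) :
    (U ^ l * D ^ (l + m + 1) * U ^ m) (b i) = if l < s i ∧ m ≤ r i then D (b i) else 0 := by
  rw [Module.End.mul_apply, Module.End.mul_apply]
  by_cases hm : m ≤ r i
  · rw [show l + m + 1 = (l + 1) + m by ring, pow_add, Module.End.mul_apply, h.down_pow_up_pow hm]
    by_cases hl : l < s i
    · have h1 := h.up_down i (by omega)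
      rw [if_pos ⟨hl, hm⟩, pow_succ D, Module.End.mul_apply, h.down, if_pos (by omega),
        h.symm.down_pow_up_pow (by omega)]
    · rw [if_neg (by tauto), h.down_pow, if_neg (by omega), map_zero]
  · rw [if_neg (by tauto), h.up_pow, if_neg hm, map_zero, map_zero]

/-- On a string, the operator `M̄` is the downward shift with the coefficients `s (r + 1)` of the
irreducible representation of `𝔰𝔩₂` whose dimension is the length of the string: the term of
`M̄` with indices `i`, `l` acts as the shift if `l < s` and `i - l - 1 ≤ r`, and as zero
otherwise. -/
theorem barM_apply (h : IsShiftPair U D b g g' r s) {p : ℕ} {i : ι} (hp : r i + s i + 1 ≤ p) :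
    barM p U D (b i) = ((s i * (r i + 1) : ℕ) : ℝ) • D (b i) := by
  have key : ∀ j ∈ Finset.Icc 1 (p - 1), ∀ l ∈ Finset.range j,
      (U ^ l * D ^ j * U ^ (j - l - 1)) (b i) =
        if l < s i ∧ j - l - 1 ≤ r i then D (b i) else 0 := by
    intro j _ l hl
    rw [Finset.mem_range] at hl
    have := h.barM_term l (j - l - 1) i
    rwa [show l + (j - l - 1) + 1 = j by omega] at this
  rw [barM, LinearMap.sum_apply]
  simp only [LinearMap.sum_apply]
  rw [Finset.sum_congr rfl fun j hj => Finset.sum_congr rfl (key j hj), Finset.sum_sigma',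
    ← Finset.sum_filter, Finset.sum_const, Nat.cast_smul_eq_nsmul]
  congr 1
  rw [← Finset.card_range (s i), ← Finset.card_range (r i + 1), ← Finset.card_product]
  refine Finset.card_nbij' (fun x => (x.2, x.1 - x.2 - 1)) (fun y => ⟨y.1 + y.2 + 1, y.1⟩)
    ?_ ?_ ?_ ?_
  · rintro ⟨j, l⟩ hx
    simp at hx ⊢
    omega
  · rintro ⟨l, m⟩ hx
    simp at hx ⊢
    omega
  · rintro ⟨j, l⟩ hx
    simp at hx ⊢
    omega
  · rintro ⟨l, m⟩ hx
    simp
    omega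

theorem barM_pow_apply (h : IsShiftPair U D b g g' r s) {p : ℕ}
    (hp : ∀ i, r i + s i + 1 ≤ p) (k : ℕ) (i : ι) :
    ∃ c : ℝ, c ≠ 0 ∧ (barM p U D ^ k) (b i) = c • (D ^ k) (b i) := by
  induction k generalizing i with
  | zero => exact ⟨1, one_ne_zero, by simp⟩
  | succ k ih =>
    rw [pow_succ, Module.End.mul_apply, h.barM_apply (hp i), pow_succ D, Module.End.mul_apply,
      h.down]
    by_cases hs : 0 < s i
    · obtain ⟨c, hc, hk⟩ := ih (g' i)
      refine ⟨(s i * (r i + 1) : ℕ) * c, mul_ne_zero (by positivity) hc, ?_⟩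
      rw [if_pos hs, map_smul, hk, smul_smul]
    · exact ⟨1, one_ne_zero, by simp [hs]⟩

/-- The initial vector of a string is an eigenvector of `H̄`, its weight being the length of the
string minus one. -/
theorem barH_apply (h : IsShiftPair U D b g g' r s) {p : ℕ} {i : ι} (hp : r i + s i + 1 ≤ p)
    (hs : s i = 0) : barH p U D (b i) = (r i : ℝ) • b i := by
  have key : ∀ j ∈ Finset.Icc 1 (p - 1),
      (D ^ j * U ^ j - U ^ j * D ^ j) (b i) = if j ≤ r i then b i else 0 := by
    intro j hj
    rw [Finset.mem_Icc] at hj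
    rw [LinearMap.sub_apply, Module.End.mul_apply, Module.End.mul_apply, h.down_pow,
      if_neg (by omega), map_zero, sub_zero]
    split_ifs with hr
    · exact h.down_pow_up_pow hr
    · rw [h.up_pow, if_neg hr, map_zero]
  rw [barH, LinearMap.sum_apply, Finset.sum_congr rfl key, ← Finset.sum_filter, Finset.sum_const,
    Nat.cast_smul_eq_nsmul]
  have : (Finset.Icc 1 (p - 1)).filter (· ≤ r i) = Finset.Icc 1 (r i) := by
    ext j
    simp
    omega
  rw [this, Nat.card_Icc, Nat.add_sub_cancel]

end IsShiftPair

/-! ### Functoriality of the bar construction -/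

theorem map_barM {R S : Type*} [Ring R] [Ring S] (f : R →+* S) (p : ℕ) (N M : R) :
    f (barM p N M) = barM p (f N) (f M) := by
  simp [barM]

theorem semiconjBy_barM {R : Type*} [Ring R] (p : ℕ) {a N M N' M' : R} (hN : SemiconjBy a N N')
    (hM : SemiconjBy a M M') : SemiconjBy a (barM p N M) (barM p N' M') := by
  have : ∀ i l, SemiconjBy a (N ^ l * M ^ i * N ^ (i - l - 1))
      (N' ^ l * M' ^ i * N' ^ (i - l - 1)) :=
    fun i l => ((hN.pow_right l).mul_right (hM.pow_right i)).mul_right (hN.pow_right _)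
  simp only [SemiconjBy, barM, Finset.mul_sum, Finset.sum_mul] at this ⊢
  simp only [this]

/-! ### Positions inside the two blocks -/

section Blocks

variable {k₁ k₂ : ℕ}

/-- The number of positions before `i` in its block. -/
def lo (i : Fin (k₁ + k₂)) : ℕ := if (i : ℕ) < k₁ then i else i - k₁

/-- The number of positions after `i` in its block. -/
def hi (i : Fin (k₁ + k₂)) : ℕ := if (i : ℕ) < k₁ then k₁ - 1 - i else k₁ + k₂ - 1 - i

/-- The predecessor of a position; the value at the first position of a block is irrelevant. -/
def prev (i : Fin (k₁ + k₂)) : Fin (k₁ + k₂) := ⟨i - 1, by omega⟩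

/-- The successor of a position; the value at the last position of a block is irrelevant. -/
def next (i : Fin (k₁ + k₂)) : Fin (k₁ + k₂) :=
  ⟨if (i : ℕ) + 1 < k₁ + k₂ then i + 1 else i, by split_ifs <;> omega⟩

theorem next_of_hi_pos {i : Fin (k₁ + k₂)} (h : 0 < hi i) :
    prev (next i) = i ∧ hi (next i) = hi i - 1 ∧ lo (next i) = lo i + 1 := by
  have := i.2
  simp only [hi, lo, prev, next, Fin.ext_iff] at h ⊢
  split_ifs at h ⊢ <;> omega

theorem prev_of_lo_pos {i : Fin (k₁ + k₂)} (h : 0 < lo i) :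
    next (prev i) = i ∧ lo (prev i) = lo i - 1 ∧ hi (prev i) = hi i + 1 := by
  have := i.2
  simp only [hi, lo, prev, next, Fin.ext_iff] at h ⊢
  grind

theorem hi_add_lo (i : Fin (k₁ + k₂)) :
    hi i + lo i + 1 = if (i : ℕ) < k₁ then k₁ else k₂ := by
  have := i.2
  simp only [hi, lo]
  split_ifs <;> omega

theorem hi_add_lo_le (hk : k₁ ≤ k₂) (i : Fin (k₁ + k₂)) : hi i + lo i + 1 ≤ k₂ := by
  rw [hi_add_lo]
  split_ifs <;> omega

theorem prev_lt_iff {i : Fin (k₁ + k₂)} (h : 0 < lo i) : (prev i : ℕ) < k₁ ↔ (i : ℕ) < k₁ := by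
  simp only [lo, prev] at *
  split_ifs at * <;> omega

/-- The ones of the `i`-th row of the Jordan matrix, through the successor of `i`. -/
theorem jordanTwo_eq_ite (i j : Fin (k₁ + k₂)) :
    jordanTwo k₁ k₂ i j = if 0 < hi i ∧ j = next i then 1 else 0 := by
  have := i.2
  have := j.2
  rw [jordanTwo]
  congr 1
  simp only [hi, next, Fin.ext_iff, eq_iff_iff]
  split_ifs <;> omega

/-- The ones of the `j`-th column of the Jordan matrix, through the predecessor of `j`. -/
theorem jordanTwo_eq_ite' (i j : Fin (k₁ + k₂)) :
    jordanTwo k₁ k₂ i j = if 0 < lo j ∧ i = prev j then 1 else 0 := by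
  have := i.2
  have := j.2
  rw [jordanTwo]
  congr 1
  simp only [lo, prev, Fin.ext_iff, eq_iff_iff]
  split_ifs <;> omega

/-! ### The Jordan matrix acting on vectors -/

/-- On column vectors the Jordan matrix lowers the index of a unit vector, so `prev` is the upward
shift of this pair, in contrast to the pair on monomials. -/
theorem isShiftPair_mulVecLin :
    IsShiftPair (jordanTwo k₁ k₂).mulVecLin (jordanTwo k₁ k₂).transpose.mulVecLin
      (fun i => Pi.single i (1 : ℝ)) prev next lo hi where
  up i := by
    ext j
    simp only [Matrix.mulVecLin_apply, Matrix.mulVec_single_one, Matrix.col_apply,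
      jordanTwo_eq_ite']
    split_ifs <;> simp_all
  down i := by
    ext j
    simp only [Matrix.mulVecLin_apply, Matrix.mulVec_single_one, Matrix.col_apply,
      Matrix.transpose_apply, jordanTwo_eq_ite]
    split_ifs <;> simp_all
  down_up _ h := prev_of_lo_pos h
  up_down _ h := next_of_hi_pos h

theorem jordanTwo_pow_mulVec_single (m : ℕ) (i : Fin (k₁ + k₂)) :
    (jordanTwo k₁ k₂ ^ m).mulVec (Pi.single i 1) =
      if m ≤ lo i then Pi.single (prev^[m] i) 1 else 0 := by
  have := isShiftPair_mulVecLin.up_pow m i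
  rwa [← Matrix.toLin'_apply', ← Matrix.toLin'_pow, Matrix.toLin'_apply] at this

theorem isNilpotent_jordanTwo (hk : k₁ ≤ k₂) : IsNilpotent (jordanTwo k₁ k₂) := by
  refine ⟨k₂, Matrix.ext_of_mulVec_single fun i => ?_⟩
  rw [jordanTwo_pow_mulVec_single, if_neg (by have := hi_add_lo_le hk i; omega), Matrix.zero_mulVec]

theorem le_nilpotencyClass (hk₁ : 1 ≤ k₁) (hk : k₁ ≤ k₂) :
    k₂ ≤ nilpotencyClass (jordanTwo k₁ k₂) := by
  by_contra! hlt
  have h := jordanTwo_pow_mulVec_single (k₁ := k₁) (k₂ := k₂)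
    (nilpotencyClass (jordanTwo k₁ k₂)) ⟨k₁ + k₂ - 1, by omega⟩
  rw [pow_nilpotencyClass (isNilpotent_jordanTwo hk), Matrix.zero_mulVec, if_pos] at h
  · exact one_ne_zero ((Pi.single_eq_same _ _).symm.trans (congrFun h.symm _))
  · simp only [lo]
    split_ifs <;> omega

/-- The matrix `M̄` is a weighted version of `M`, acting on coordinates as a shift. -/
theorem sum_barM_jordanTwo {W : Type*} [AddCommGroup W] [Module ℝ W] {p : ℕ} (hk : k₁ ≤ k₂)
    (hp : k₂ ≤ p) (φ : Fin (k₁ + k₂) → W) (i : Fin (k₁ + k₂)) :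
    ∑ j, barM p (jordanTwo k₁ k₂) (jordanTwo k₁ k₂).transpose i j • φ j =
      if 0 < lo i then (((hi i + 1) * lo i : ℕ) : ℝ) • φ (prev i) else 0 := by
  have key : ∀ j, barM p (jordanTwo k₁ k₂) (jordanTwo k₁ k₂).transpose i j =
      if 0 < lo i ∧ j = prev i then (((hi i + 1) * lo i : ℕ) : ℝ) else 0 := by
    intro j
    have h1 := isShiftPair_mulVecLin.barM_apply (p := p) (i := j)
      (by have := hi_add_lo_le hk j; omega)
    have h2 := map_barM (Matrix.toLinAlgEquiv' (R := ℝ) (n := Fin (k₁ + k₂))).toRingEquiv.toRingHom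
      p (jordanTwo k₁ k₂) (jordanTwo k₁ k₂).transpose
    have h3 : ∀ A, (Matrix.toLinAlgEquiv' (R := ℝ) (n := Fin (k₁ + k₂))).toRingEquiv.toRingHom A =
      A.mulVecLin := fun _ => rfl
    rw [h3, h3, h3] at h2
    rw [← h2] at h1
    have h4 := congrFun h1 i
    simp only [Matrix.mulVecLin_apply, Matrix.mulVec_single_one, Matrix.col_apply, Pi.smul_apply,
      Matrix.transpose_apply, jordanTwo_eq_ite', smul_eq_mul] at h4
    rw [h4]
    split_ifs with h
    · rw [h.2, (prev_of_lo_pos h.1).2.1, (prev_of_lo_pos h.1).2.2,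
        Nat.sub_add_cancel h.1, mul_one]
    · rw [mul_zero]
  simp only [key, ite_and, ite_smul, zero_smul]
  split_ifs <;> simp

/-! ### Solving the kernel equation by recursion along the blocks -/

theorem pow_mem_of_forall_mem {W : Type*} [AddCommGroup W] [Module ℝ W] {H : Submodule ℝ W}
    {A : Module.End ℝ W} (hA : ∀ w ∈ H, A w ∈ H) (m : ℕ) : ∀ w ∈ H, (A ^ m) w ∈ H := by
  induction m with
  | zero => exact fun w hw => hw
  | succ m ih => exact fun w hw => by rw [pow_succ, Module.End.mul_apply]; exact ih _ (hA w hw)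

/-- The recursion `(hi i + 1) (lo i) φ (i - 1) = Y (φ i)` along each block expresses every
component of a solution by the components at the two ends. The solutions with components in `H`
are therefore parametrized by the elements of `H` killed by `Y ^ k₁` and by `Y ^ k₂`. -/
theorem finrank_recursion (hk₁ : 1 ≤ k₁) (hk : k₁ ≤ k₂) {W : Type*} [AddCommGroup W] [Module ℝ W]
    (Y : Module.End ℝ W) (H : Submodule ℝ W) [Module.Finite ℝ H] (hY : ∀ w ∈ H, Y w ∈ H)
    (K : Submodule ℝ (Fin (k₁ + k₂) → W))
    (hK : ∀ φ, φ ∈ K ↔ (∀ i, φ i ∈ H) ∧ ∀ i, Y (φ i) =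
      if 0 < lo i then (((hi i + 1) * lo i : ℕ) : ℝ) • φ (prev i) else 0) :
    Module.finrank ℝ K = Module.finrank ℝ (LinearMap.ker (Y ^ k₁) ⊓ H : Submodule ℝ W) +
      Module.finrank ℝ (LinearMap.ker (Y ^ k₂) ⊓ H : Submodule ℝ W) := by
  -- the weights `lo! / hi!` solve the scalar recursion
  let c : Fin (k₁ + k₂) → ℝ := fun i => ((lo i).factorial : ℝ) / ((hi i).factorial : ℝ)
  have hc : ∀ i, 0 < lo i → (((hi i + 1) * lo i : ℕ) : ℝ) * c (prev i) = c i := by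
    intro i h
    obtain ⟨m, hm⟩ : ∃ m, lo i = m + 1 := ⟨lo i - 1, by omega⟩
    simp only [c, (prev_of_lo_pos h).2.1, (prev_of_lo_pos h).2.2, hm, Nat.add_sub_cancel,
      Nat.factorial_succ]
    push_cast
    have : ((hi i).factorial : ℝ) ≠ 0 := by positivity
    field_simp
  have hc0 : ∀ i, c i ≠ 0 := fun i => by positivity
  let A := (LinearMap.ker (Y ^ k₁) ⊓ H : Submodule ℝ W)
  let B := (LinearMap.ker (Y ^ k₂) ⊓ H : Submodule ℝ W)
  have : Module.Finite ℝ A := Submodule.finiteDimensional_of_le inf_le_right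
  have : Module.Finite ℝ B := Submodule.finiteDimensional_of_le inf_le_right
  -- `a i` is the parameter belonging to the block of `i`
  let a : Fin (k₁ + k₂) → (A × B →ₗ[ℝ] W) := fun i =>
    if (i : ℕ) < k₁ then A.subtype ∘ₗ LinearMap.fst ℝ A B else B.subtype ∘ₗ LinearMap.snd ℝ A B
  have haH : ∀ i q, a i q ∈ H := by
    intro i q
    simp only [a]
    split_ifs
    · exact q.1.2.2
    · exact q.2.2.2
  have haY : ∀ i q, (Y ^ (hi i + lo i + 1)) (a i q) = 0 := by
    intro i q
    simp only [a, hi_add_lo]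
    split_ifs
    · exact q.1.2.1
    · exact q.2.2.1
  have haprev : ∀ i, 0 < lo i → a (prev i) = a i := fun i h => by simp only [a, prev_lt_iff h]
  let T : (A × B) →ₗ[ℝ] (Fin (k₁ + k₂) → W) := LinearMap.pi fun i => c i • ((Y ^ hi i) ∘ₗ a i)
  have hT : ∀ q i, T q i = c i • (Y ^ hi i) (a i q) := fun q i => rfl
  let e₁ : Fin (k₁ + k₂) := ⟨k₁ - 1, by omega⟩
  let e₂ : Fin (k₁ + k₂) := ⟨k₁ + k₂ - 1, by omega⟩
  have he₁ : hi e₁ = 0 := by simp only [hi, e₁]; split_ifs <;> omega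
  have he₂ : hi e₂ = 0 := by simp only [hi, e₂]; split_ifs <;> omega
  have hae₁ : ∀ q, a e₁ q = q.1 := fun q => by
    simp only [a, e₁]; rw [if_pos (by omega)]; rfl
  have hae₂ : ∀ q, a e₂ q = q.2 := fun q => by
    simp only [a, e₂]; rw [if_neg (by omega)]; rfl
  have hinj : Function.Injective T := by
    rw [← LinearMap.ker_eq_bot, LinearMap.ker_eq_bot']
    intro q hq
    have h1 := congrFun hq e₁
    have h2 := congrFun hq e₂
    rw [hT, he₁, hae₁] at h1
    rw [hT, he₂, hae₂] at h2
    ext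
    · simpa [hc0] using h1
    · simpa [hc0] using h2
  have hrange : LinearMap.range T = K := by
    ext φ
    rw [hK]
    constructor
    · rintro ⟨q, rfl⟩
      refine ⟨fun i => H.smul_mem _ (pow_mem_of_forall_mem hY _ _ (haH i q)), fun i => ?_⟩
      rw [hT, map_smul, ← Module.End.mul_apply, ← pow_succ']
      split_ifs with h
      · rw [hT, haprev i h, smul_smul, hc i h, (prev_of_lo_pos h).2.2]
      · have := haY i q
        rw [show lo i = 0 by omega, add_zero] at this
        rw [this, smul_zero]
    · rintro ⟨hH, hrec⟩
      -- the recursion determines the components of a solution, from the end of the block backwards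
      have hstep : ∀ i, 0 < hi i → φ i = (c i / c (next i)) • Y (φ (next i)) := by
        intro i h
        obtain ⟨h1, h2, h3⟩ := next_of_hi_pos h
        have h4 := hc (next i) (by omega)
        rw [h1] at h4
        have h5 := hrec (next i)
        rw [if_pos (by omega), h1] at h5
        rw [h5, smul_smul]
        rw [div_mul_eq_mul_div, mul_comm, h4, div_self (hc0 _), one_smul]
      let e : Fin (k₁ + k₂) → Fin (k₁ + k₂) := fun i => if (i : ℕ) < k₁ then e₁ else e₂
      have hsol : ∀ m i, hi i = m → φ i = (c i / c (e i)) • (Y ^ m) (φ (e i)) := by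
        intro m
        induction m with
        | zero =>
          intro i h
          have : i = e i := by
            have := i.2
            simp only [hi, e] at h ⊢
            split_ifs at h ⊢ <;> simp only [e₁, e₂, Fin.ext_iff] <;> omega
          rw [← this, div_self (hc0 _), pow_zero, one_smul, Module.End.one_apply]
        | succ m ih =>
          intro i h
          obtain ⟨h1, h2, h3⟩ := next_of_hi_pos (i := i) (by omega)
          have h4 := ih (next i) (by omega)
          have h5 : e (next i) = e i := by
            have := prev_lt_iff (i := next i) (by omega)
            rw [h1] at this
            simp only [e, this]
          rw [hstep i (by omega), h4, h5, map_smul, smul_smul, pow_succ', Module.End.mul_apply]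
          congr 1
          have := hc0 (next i)
          field_simp
      -- at the first position of a block the recursion reads `Y (φ i) = 0`
      have hfirst : ∀ i, lo i = 0 → (Y ^ (hi i + 1)) (φ (e i)) = 0 := by
        intro i h
        have h1 := hrec i
        rw [if_neg (by omega), hsol _ i rfl, map_smul, ← Module.End.mul_apply, ← pow_succ'] at h1
        exact (smul_eq_zero.mp h1).resolve_left (div_ne_zero (hc0 _) (hc0 _))
      have hA : (Y ^ k₁) (φ e₁) = 0 := by
        have := hfirst ⟨0, by omega⟩ (by simp [lo])
        simp only [hi, e, if_pos (show 0 < k₁ by omega)] at this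
        rwa [show k₁ - 1 - 0 + 1 = k₁ by omega] at this
      have hB : (Y ^ k₂) (φ e₂) = 0 := by
        have := hfirst ⟨k₁, by omega⟩ (by simp [lo])
        simp only [hi, e, if_neg (lt_irrefl k₁)] at this
        rwa [show k₁ + k₂ - 1 - k₁ + 1 = k₂ by omega] at this
      refine ⟨(⟨(c e₁)⁻¹ • φ e₁, ?_, H.smul_mem _ (hH _)⟩,
        ⟨(c e₂)⁻¹ • φ e₂, ?_, H.smul_mem _ (hH _)⟩), ?_⟩
      · simp [hA]
      · simp [hB]
      · funext i
        rw [hT, hsol _ i rfl]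
        simp only [a, e]
        split_ifs <;> simp [smul_smul, div_eq_mul_inv]
  rw [← hrange, LinearMap.finrank_range_of_inj hinj, Module.finrank_prod]

end Blocks

/-! ### The Jordan matrix acting on monomials -/

section Monomials

open MvPolynomial

theorem subst_apply {n : ℕ} (A : Matrix (Fin n) (Fin n) ℝ) (q : MvPolynomial (Fin n) ℝ) :
    subst A q = aeval (fun i => ∑ j, C (A i j) * X j) q := rfl

/-- Substitution by the matrix of a partial map `f` of the variables, defined where `P` holds. -/
theorem subst_monomial_of_partialMap {n : ℕ} {A : Matrix (Fin n) (Fin n) ℝ} {P : Fin n → Prop}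
    [DecidablePred P] {f : Fin n → Fin n} (hA : ∀ i j, A i j = if P i ∧ j = f i then 1 else 0)
    (α : Fin n →₀ ℕ) :
    subst A (monomial α 1) =
      if ∀ i ∈ α.support, P i then monomial (α.mapDomain f) 1 else 0 := by
  have hX : ∀ i, ∑ j, C (A i j) * (X j : MvPolynomial (Fin n) ℝ) = if P i then X (f i) else 0 := by
    intro i
    by_cases h : P i
    · simp [hA, h]
    · simp [hA, h]
  rw [subst_apply, aeval_monomial, map_one, one_mul]
  split_ifs with h
  · rw [← rename_monomial f, rename_eq_aeval, aeval_monomial, map_one, one_mul]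
    refine Finsupp.prod_congr fun i hi => ?_
    rw [hX, if_pos (h i hi), Function.comp_apply]
  · push Not at h
    obtain ⟨i, hi, hP⟩ := h
    rw [Finsupp.prod]
    refine Finset.prod_eq_zero hi ?_
    rw [hX, if_neg hP, zero_pow (Finsupp.mem_support_iff.mp hi)]

/-- The exponents of the nonconstant monomials. -/
abbrev NonzeroExp (n : ℕ) : Type := {α : Fin n →₀ ℕ // α ≠ 0}

/-- The least value of a function on the variables over the variables that occur. -/
def minOn {n : ℕ} (h : Fin n → ℕ) (α : NonzeroExp n) : ℕ :=
  α.1.support.inf' (Finsupp.support_nonempty_iff.mpr α.2) h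

theorem le_minOn_iff {n : ℕ} {h : Fin n → ℕ} {α : NonzeroExp n} {m : ℕ} :
    m ≤ minOn h α ↔ ∀ i ∈ α.1.support, m ≤ h i := Finset.le_inf'_iff _ _

/-- Renaming of the variables in an exponent. -/
def mapExp {n : ℕ} (f : Fin n → Fin n) (α : NonzeroExp n) : NonzeroExp n :=
  ⟨α.1.mapDomain f, fun h => α.2 <| by
    have hsum : α.1.sum (fun _ k => k) = 0 := by
      rw [← Finsupp.sum_mapDomain_index (f := f) (h := fun _ k => k) (fun _ => rfl)
        (fun _ _ _ => rfl), h, Finsupp.sum_zero_index]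
    simpa [Finsupp.sum, Finsupp.ext_iff] using hsum⟩

/-- A partial shift of the variables, with `h` counting the steps available in one direction and
`h'` those in the other, induces a partial shift of the nonconstant monomials: the steps
available to a monomial are the least number available to its variables. -/
theorem mapExp_spec {n : ℕ} {f g : Fin n → Fin n} {h h' : Fin n → ℕ}
    (hfg : ∀ i, 0 < h i → g (f i) = i ∧ h (f i) = h i - 1 ∧ h' (f i) = h' i + 1)
    (α : NonzeroExp n) (hα : 0 < minOn h α) :
    mapExp g (mapExp f α) = α ∧ minOn h (mapExp f α) = minOn h α - 1 ∧
      minOn h' (mapExp f α) = minOn h' α + 1 := by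
  have hpos : ∀ i ∈ α.1.support, 0 < h i := le_minOn_iff.mp hα
  have hinj : Set.InjOn f α.1.support := fun i hi j hj hij => by
    rw [← (hfg i (hpos i hi)).1, hij, (hfg j (hpos j hj)).1]
  have hsupp : (mapExp f α).1.support = α.1.support.image f :=
    Finsupp.mapDomain_support_of_injOn _ hinj
  have hmin : ∀ h₀ m, m ≤ minOn h₀ (mapExp f α) ↔ ∀ i ∈ α.1.support, m ≤ h₀ (f i) := by
    intro h₀ m
    rw [le_minOn_iff, hsupp, Finset.forall_mem_image]
  refine ⟨?_, ?_, ?_⟩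
  · apply Subtype.ext
    refine Eq.trans (Finsupp.mapDomain_comp (f := f) (g := g) (v := α.1)).symm ?_
    exact (Finsupp.mapDomain_congr fun i hi => (hfg i (hpos i hi)).1).trans Finsupp.mapDomain_id
  · refine eq_of_forall_le_iff fun m => ?_
    rw [hmin, Nat.le_sub_iff_add_le hα, le_minOn_iff]
    refine forall₂_congr fun i hi => ?_
    have := hpos i hi
    rw [(hfg i this).2.1]
    omega
  · refine eq_of_forall_le_iff fun m => ?_
    rw [hmin, ← Nat.sub_le_iff_le_add, le_minOn_iff]
    refine forall₂_congr fun i hi => ?_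
    rw [(hfg i (hpos i hi)).2.2]
    omega

variable {k₁ k₂ : ℕ}

theorem isShiftPair_subst :
    IsShiftPair (subst (jordanTwo k₁ k₂)) (subst (jordanTwo k₁ k₂).transpose)
      (fun α : NonzeroExp (k₁ + k₂) => (monomial α.1 1 : MvPolynomial _ ℝ))
      (mapExp next) (mapExp prev) (minOn hi) (minOn lo) where
  up α := by
    rw [subst_monomial_of_partialMap (P := fun i => 0 < hi i) (f := next) jordanTwo_eq_ite]
    exact if_congr le_minOn_iff.symm rfl rfl
  down α := by
    rw [subst_monomial_of_partialMap (A := (jordanTwo k₁ k₂).transpose) (P := fun i => 0 < lo i)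
      (f := prev) fun i j => jordanTwo_eq_ite' j i]
    exact if_congr le_minOn_iff.symm rfl rfl
  down_up α h := mapExp_spec (fun _ => next_of_hi_pos) α h
  up_down α h := mapExp_spec (fun _ => prev_of_lo_pos) α h

theorem minOn_hi_add_minOn_lo_le (hk : k₁ ≤ k₂) (α : NonzeroExp (k₁ + k₂)) :
    minOn hi α + minOn lo α + 1 ≤ k₂ := by
  obtain ⟨i, hi'⟩ := Finsupp.support_nonempty_iff.mpr α.2
  have h1 := le_minOn_iff.mp (le_refl (minOn hi α)) i hi'
  have h2 := le_minOn_iff.mp (le_refl (minOn lo α)) i hi'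
  have h3 := hi_add_lo_le hk i
  omega

/-! ### The kernels of the powers of `S_{M̄}` -/

theorem substBarM_pow_monomial (hk₁ : 1 ≤ k₁) (hk : k₁ ≤ k₂) (k : ℕ) (α : NonzeroExp (k₁ + k₂)) :
    ∃ c : ℝ, c ≠ 0 ∧
      (substBarM (jordanTwo k₁ k₂) (jordanTwo k₁ k₂).transpose ^ k) (monomial α.1 1) =
        if k ≤ minOn lo α then c • monomial ((mapExp prev)^[k] α).1 1 else 0 := by
  obtain ⟨c, hc, h⟩ := (isShiftPair_subst (k₁ := k₁) (k₂ := k₂)).barM_pow_apply (fun α =>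
    (minOn_hi_add_minOn_lo_le hk α).trans (le_nilpotencyClass hk₁ hk)) k α
  refine ⟨c, hc, ?_⟩
  rw [isShiftPair_subst.down_pow, smul_ite, smul_zero] at h
  exact h

/-- The `k`-th power of `S_{M̄}` maps the nonconstant monomials it does not kill to nonzero multiples
of distinct monomials, so its kernel is spanned by the monomials it kills. -/
theorem ker_substBarM_pow_inf_restrictSupport (hk₁ : 1 ≤ k₁) (hk : k₁ ≤ k₂) (k : ℕ)
    {S : Set (Fin (k₁ + k₂) →₀ ℕ)} (hS : 0 ∉ S) :
    LinearMap.ker (substBarM (jordanTwo k₁ k₂) (jordanTwo k₁ k₂).transpose ^ k) ⊓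
      restrictSupport ℝ S = restrictSupport ℝ (S ∩ {α | ∃ i ∈ α.support, lo i < k}) := by
  set Y := substBarM (jordanTwo k₁ k₂) (jordanTwo k₁ k₂).transpose
  have hne : ∀ α ∈ S, α ≠ 0 := fun α hα h => hS (h ▸ hα)
  apply le_antisymm
  · rintro q ⟨hq, hqS⟩ α hα
    refine ⟨hqS hα, ?_⟩
    by_contra hcon
    simp only [Set.mem_ofPred_eq, not_exists, not_and, not_lt] at hcon
    let α' : NonzeroExp (k₁ + k₂) := ⟨α, hne α (hqS hα)⟩
    have hα' : k ≤ minOn lo α' := le_minOn_iff.mpr hcon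
    obtain ⟨c, hc, hYα⟩ := substBarM_pow_monomial hk₁ hk k α'
    -- only the monomial `α` contributes to the coefficient at its image under the shift
    have key : ∀ q ∈ restrictSupport ℝ S,
        coeff ((mapExp prev)^[k] α').1 ((Y ^ k) q) = c * coeff α q := by
      intro q hq
      rw [restrictSupport_eq_span] at hq
      induction hq using Submodule.span_induction with
      | mem _ h =>
        obtain ⟨β, hβ, rfl⟩ := h
        by_cases hαβ : β = α
        · subst hαβ
          rw [hYα, if_pos hα']
          simp
        · let β' : NonzeroExp (k₁ + k₂) := ⟨β, hne β hβ⟩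
          obtain ⟨d, -, hYβ⟩ := substBarM_pow_monomial hk₁ hk k β'
          rw [hYβ, coeff_monomial, if_neg hαβ, mul_zero]
          split_ifs with hβ'
          · rw [coeff_smul, coeff_monomial, if_neg, smul_zero]
            intro heq
            have h1 := isShiftPair_subst.iterate_up_down hβ'
            rw [Subtype.ext heq, isShiftPair_subst.iterate_up_down hα'] at h1
            exact hαβ (congrArg Subtype.val h1.symm)
          · simp
      | zero => simp
      | add x y _ _ hx hy => rw [map_add, coeff_add, coeff_add, hx, hy, mul_add]
      | smul r x _ hx => rw [map_smul, coeff_smul, coeff_smul, hx, smul_eq_mul, smul_eq_mul]; ring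
    have h := key q hqS
    rw [LinearMap.mem_ker.mp hq, coeff_zero] at h
    exact mem_support_iff.mp hα ((mul_eq_zero.mp h.symm).resolve_left hc)
  · refine le_inf ?_ (restrictSupport_mono ℝ Set.inter_subset_left)
    rw [restrictSupport_eq_span, Submodule.span_le]
    rintro _ ⟨α, ⟨hαS, i, hi, hlt⟩, rfl⟩
    obtain ⟨c, -, hY⟩ := substBarM_pow_monomial hk₁ hk k ⟨α, hne α hαS⟩
    refine LinearMap.mem_ker.mpr (hY.trans (if_neg fun hle => ?_))
    have := le_minOn_iff.mp hle i hi
    omega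

/-! ### Counting monomials -/

theorem homogeneousSubmodule_eq_restrictSupport (n d : ℕ) :
    homogeneousSubmodule (Fin n) ℝ d = restrictSupport ℝ {α | α.degree = d} := by
  ext q
  rw [mem_homogeneousSubmodule, mem_restrictSupport_iff, IsHomogeneous, IsWeightedHomogeneous]
  simp only [Set.subset_def, Finset.mem_coe, mem_support_iff, Set.mem_ofPred_eq,
    Finsupp.degree_eq_weight_one]
  rfl

theorem mem_finsuppAntidiag_iff {n : ℕ} {s : Finset (Fin n)} {d : ℕ} {α : Fin n →₀ ℕ} :
    α ∈ s.finsuppAntidiag d ↔ α.degree = d ∧ α.support ⊆ s := by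
  rw [Finset.mem_finsuppAntidiag']
  rfl

theorem finrank_restrictSupport_finset {n : ℕ} (F : Finset (Fin n →₀ ℕ)) :
    Module.finrank ℝ (restrictSupport ℝ (F : Set (Fin n →₀ ℕ))) = F.card := by
  rw [Module.finrank_eq_nat_card_basis (basisRestrictSupport ℝ (F : Set (Fin n →₀ ℕ)))]
  simp

instance finite_homogeneousSubmodule (n d : ℕ) :
    Module.Finite ℝ (homogeneousSubmodule (Fin n) ℝ d) := by
  rw [homogeneousSubmodule_eq_restrictSupport]
  have : {α : Fin n →₀ ℕ | α.degree = d} =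
      ((Finset.univ : Finset (Fin n)).finsuppAntidiag d : Finset _) := by
    ext α
    rw [Finset.mem_coe, mem_finsuppAntidiag_iff]
    simp
  rw [this]
  exact Module.Finite.of_basis (basisRestrictSupport ℝ _)

/-- The monomials of degree `d` not killed by the `k`-th power of `S_{M̄}` are those in the variables
with at least `k` positions before them. -/
theorem finrank_ker_substBarM_pow (hk₁ : 1 ≤ k₁) (hk : k₁ ≤ k₂) (k : ℕ) {d : ℕ} (hd : d ≠ 0) :
    (Module.finrank ℝ (LinearMap.ker
        (substBarM (jordanTwo k₁ k₂) (jordanTwo k₁ k₂).transpose ^ k) ⊓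
          homogeneousSubmodule (Fin (k₁ + k₂)) ℝ d : Submodule ℝ _) : ℚ) =
      (k₁ + k₂).multichoose d -
        (Finset.univ.filter fun i : Fin (k₁ + k₂) => k ≤ lo i).card.multichoose d := by
  rw [homogeneousSubmodule_eq_restrictSupport,
    ker_substBarM_pow_inf_restrictSupport hk₁ hk k (by simpa using hd.symm)]
  set s := Finset.univ.filter fun i : Fin (k₁ + k₂) => k ≤ lo i
  have h1 : {α : Fin (k₁ + k₂) →₀ ℕ | α.degree = d} ∩ {α | ∃ i ∈ α.support, lo i < k} =
      (Finset.univ.finsuppAntidiag d \ s.finsuppAntidiag d : Finset _) := by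
    ext α
    have hs : α.support ⊆ s ↔ ∀ i ∈ α.support, k ≤ lo i := by simp [s, Finset.subset_iff]
    simp only [Set.mem_inter_iff, Set.mem_ofPred_eq, Finset.coe_sdiff, Set.mem_sdiff,
      Finset.mem_coe, mem_finsuppAntidiag_iff, Finset.subset_univ, and_true, hs, not_and]
    refine and_congr_right fun h => ?_
    simp only [h, true_imp_iff, not_forall, not_le, exists_prop]
  have h2 : s.finsuppAntidiag d ⊆ Finset.univ.finsuppAntidiag d := fun α => by
    simp only [mem_finsuppAntidiag_iff, Finset.subset_univ, and_true]
    exact And.left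
  rw [h1, finrank_restrictSupport_finset, Finset.cast_card_sdiff h2,
    Finset.card_finsuppAntidiag_nat_eq_multichoose, Finset.card_finsuppAntidiag_nat_eq_multichoose,
    Finset.card_univ, Fintype.card_fin]

theorem card_filter_le_lo (hk : k₁ ≤ k₂) :
    (Finset.univ.filter fun i : Fin (k₁ + k₂) => k₁ ≤ lo i).card = k₂ - k₁ ∧
      (Finset.univ.filter fun i : Fin (k₁ + k₂) => k₂ ≤ lo i).card = 0 := by
  constructor
  · rw [← Finset.card_map Fin.valEmbedding, show k₂ - k₁ = k₁ + k₂ - 2 * k₁ by omega,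
      ← Nat.card_Ico]
    congr 1
    ext m
    simp only [Finset.mem_map, Finset.mem_filter, Finset.mem_univ, true_and, Finset.mem_Ico,
      Fin.valEmbedding_apply]
    simp only [lo]
    constructor
    · rintro ⟨i, h, rfl⟩
      have := i.2
      split_ifs at h <;> omega
    · rintro ⟨h1, h2⟩
      refine ⟨⟨m, h2⟩, ?_, rfl⟩
      split_ifs <;> simp only at * <;> omega
  · rw [Finset.card_eq_zero, Finset.filter_eq_empty_iff]
    intro i _
    have := hi_add_lo_le hk i
    omega

end Monomials

/-! ### The kernel of `Δ_{M̄}` for the Jordan form -/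

section Delta

open MvPolynomial

theorem multV_apply {n : ℕ} (A : Matrix (Fin n) (Fin n) ℝ) (φ : Fin n → MvPolynomial (Fin n) ℝ)
    (i : Fin n) : multV A φ i = ∑ j, A i j • φ j := by
  simp [multV]

theorem substV_apply {n : ℕ} (A : Matrix (Fin n) (Fin n) ℝ) (φ : Fin n → MvPolynomial (Fin n) ℝ)
    (i : Fin n) : substV A φ i = subst A (φ i) := rfl

/-- The action of matrices on polynomial maps by multiplication, as a ring homomorphism. -/
def multVHom (n : ℕ) :
    Matrix (Fin n) (Fin n) ℝ →+* Module.End ℝ (Fin n → MvPolynomial (Fin n) ℝ) where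
  toFun := multV
  map_one' := by
    refine LinearMap.ext fun φ => funext fun i => ?_
    simp [multV_apply, Matrix.one_apply]
  map_mul' A B := by
    refine LinearMap.ext fun φ => funext fun i => ?_
    simp only [multV_apply, Module.End.mul_apply, Matrix.mul_apply, Finset.sum_smul,
      Finset.smul_sum, mul_smul]
    exact Finset.sum_comm
  map_zero' := by
    refine LinearMap.ext fun φ => funext fun i => ?_
    simp [multV_apply]
  map_add' A B := by
    refine LinearMap.ext fun φ => funext fun i => ?_
    simp [multV_apply, add_smul, Finset.sum_add_distrib]

theorem multVHom_apply {n : ℕ} (A : Matrix (Fin n) (Fin n) ℝ) : multVHom n A = multV A := rfl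

/-- The componentwise action of operators, as a ring homomorphism. -/
def compLeftHom (ι W : Type*) [AddCommGroup W] [Module ℝ W] :
    Module.End ℝ W →+* Module.End ℝ (ι → W) where
  toFun A := A.compLeft ι
  map_one' := rfl
  map_mul' _ _ := rfl
  map_zero' := rfl
  map_add' _ _ := rfl

theorem compLeftHom_apply {ι W : Type*} [AddCommGroup W] [Module ℝ W] (A : Module.End ℝ W) :
    compLeftHom ι W A = A.compLeft ι := rfl

theorem deltaBarM_apply {n : ℕ} (N M : Matrix (Fin n) (Fin n) ℝ)
    (φ : Fin n → MvPolynomial (Fin n) ℝ) (i : Fin n) :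
    deltaBarM N M φ i =
      ∑ j, barM (nilpotencyClass N) N M i j • φ j - substBarM N M (φ i) := by
  have h1 : barM (nilpotencyClass N) (multV N) (multV M) = multV (barM (nilpotencyClass N) N M) :=
    by rw [← multVHom_apply, ← multVHom_apply, ← multVHom_apply, map_barM]
  have h2 : barM (nilpotencyClass N) (substV N) (substV M) =
      (substBarM N M).compLeft (Fin n) :=
    by rw [substBarM, ← compLeftHom_apply, map_barM, compLeftHom_apply, compLeftHom_apply, substV,
      substV]
  rw [deltaBarM, h1, h2, LinearMap.sub_apply, Pi.sub_apply, multV_apply,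
    LinearMap.compLeft_apply, Function.comp_apply]

theorem mem_homogV_iff {n d : ℕ} {φ : Fin n → MvPolynomial (Fin n) ℝ} :
    φ ∈ homogV n d ↔ ∀ i, φ i ∈ homogeneousSubmodule (Fin n) ℝ d := by
  simp [homogV, Submodule.mem_pi]

theorem subst_mem_homogeneousSubmodule {n d : ℕ} (A : Matrix (Fin n) (Fin n) ℝ)
    {q : MvPolynomial (Fin n) ℝ} (hq : q ∈ homogeneousSubmodule (Fin n) ℝ d) :
    subst A q ∈ homogeneousSubmodule (Fin n) ℝ d := by
  rw [mem_homogeneousSubmodule] at *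
  rw [subst_apply, ← one_mul d]
  refine hq.aeval _ fun i => IsHomogeneous.sum _ _ _ fun j _ => ?_
  simpa using (isHomogeneous_C _ (A i j)).mul (isHomogeneous_X ℝ j)

theorem substBarM_mem_homogeneousSubmodule {n d : ℕ} (N M : Matrix (Fin n) (Fin n) ℝ)
    {q : MvPolynomial (Fin n) ℝ} (hq : q ∈ homogeneousSubmodule (Fin n) ℝ d) :
    substBarM N M q ∈ homogeneousSubmodule (Fin n) ℝ d := by
  have h := fun A (m : ℕ) => pow_mem_of_forall_mem
    (fun w hw => subst_mem_homogeneousSubmodule (d := d) (n := n) A hw) m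
  rw [substBarM, barM, LinearMap.sum_apply]
  refine Submodule.sum_mem _ fun i _ => ?_
  rw [LinearMap.sum_apply]
  exact Submodule.sum_mem _ fun l _ => h _ _ _ (h _ _ _ (h _ _ _ hq))

variable {k₁ k₂ : ℕ}

theorem finrank_ker_deltaBarM (hk₁ : 1 ≤ k₁) (hk : k₁ ≤ k₂) {d : ℕ} (hd : d ≠ 0) :
    (Module.finrank ℝ (LinearMap.ker (deltaBarM (jordanTwo k₁ k₂) (jordanTwo k₁ k₂).transpose) ⊓
        homogV (k₁ + k₂) d : Submodule ℝ _) : ℚ) =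
      2 * (k₁ + k₂).multichoose d - (k₂ - k₁).multichoose d := by
  rw [finrank_recursion hk₁ hk (substBarM (jordanTwo k₁ k₂) (jordanTwo k₁ k₂).transpose)
    (homogeneousSubmodule (Fin (k₁ + k₂)) ℝ d)
    (fun w hw => substBarM_mem_homogeneousSubmodule _ _ hw)]
  · obtain ⟨m, rfl⟩ := Nat.exists_eq_succ_of_ne_zero hd
    rw [Nat.cast_add, finrank_ker_substBarM_pow hk₁ hk _ hd, finrank_ker_substBarM_pow hk₁ hk _ hd,
      (card_filter_le_lo hk).1, (card_filter_le_lo hk).2, Nat.multichoose_zero_succ]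
    push_cast
    ring
  · intro φ
    rw [Submodule.mem_inf, and_comm, mem_homogV_iff, LinearMap.mem_ker, funext_iff]
    refine and_congr_right fun _ => forall_congr' fun i => ?_
    rw [deltaBarM_apply, sum_barM_jordanTwo hk (le_nilpotencyClass hk₁ hk), Pi.zero_apply,
      sub_eq_zero, eq_comm]

theorem finrank_ker_barM_jordanTwo (hk₁ : 1 ≤ k₁) (hk : k₁ ≤ k₂) :
    Module.finrank ℝ (LinearMap.ker (barM (nilpotencyClass (jordanTwo k₁ k₂)) (jordanTwo k₁ k₂)
      (jordanTwo k₁ k₂).transpose).mulVecLin) = 2 := by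
  rw [finrank_recursion hk₁ hk (W := ℝ) 0 ⊤ (fun _ _ => trivial)]
  · rw [zero_pow (by omega), zero_pow (by omega), LinearMap.ker_zero, inf_top_eq, finrank_top,
      Module.finrank_self]
  · intro φ
    rw [LinearMap.mem_ker, Matrix.mulVecLin_apply, funext_iff]
    simp only [Submodule.mem_top, implies_true, true_and]
    refine forall_congr' fun i => ?_
    rw [← sum_barM_jordanTwo hk (le_nilpotencyClass hk₁ hk), LinearMap.zero_apply, eq_comm]
    rfl

/-! ### Invariance under conjugation -/

theorem subst_mul {n : ℕ} (A B : Matrix (Fin n) (Fin n) ℝ) :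
    subst (A * B) = subst B * subst A := by
  have : (aeval fun i => ∑ j, C ((A * B) i j) * X j : MvPolynomial (Fin n) ℝ →ₐ[ℝ] _) =
      (aeval fun i => ∑ j, C (B i j) * X j).comp (aeval fun i => ∑ j, C (A i j) * X j) := by
    refine algHom_ext fun i => ?_
    simp only [aeval_X, AlgHom.comp_apply, map_sum, map_mul, algHom_C, algebraMap_eq,
      Matrix.mul_apply, Finset.sum_mul, Finset.mul_sum, mul_assoc]
    exact Finset.sum_comm
  exact LinearMap.ext fun q => DFunLike.congr_fun this q

theorem substV_mul {n : ℕ} (A B : Matrix (Fin n) (Fin n) ℝ) :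
    substV (A * B) = substV B * substV A := by
  rw [substV, subst_mul]
  rfl

theorem subst_one {n : ℕ} : subst (1 : Matrix (Fin n) (Fin n) ℝ) = 1 := by
  have : (aeval fun i => ∑ j, C ((1 : Matrix (Fin n) (Fin n) ℝ) i j) * X j :
      MvPolynomial (Fin n) ℝ →ₐ[ℝ] _) = AlgHom.id ℝ _ := by
    refine algHom_ext fun i => ?_
    simp [Matrix.one_apply]
  exact LinearMap.ext fun q => DFunLike.congr_fun this q

theorem substV_one {n : ℕ} : substV (1 : Matrix (Fin n) (Fin n) ℝ) = 1 := by
  rw [substV, subst_one]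
  rfl

theorem multV_mul_substV {n : ℕ} (A B : Matrix (Fin n) (Fin n) ℝ) :
    multV A * substV B = substV B * multV A := by
  refine LinearMap.ext fun φ => funext fun i => ?_
  simp [multV_apply, substV_apply, Module.End.mul_apply]

theorem multV_mem_homogV {n d : ℕ} (A : Matrix (Fin n) (Fin n) ℝ)
    {φ : Fin n → MvPolynomial (Fin n) ℝ} (hφ : φ ∈ homogV n d) : multV A φ ∈ homogV n d := by
  rw [mem_homogV_iff] at *
  intro i
  rw [multV_apply]
  exact Submodule.sum_mem _ fun j _ => Submodule.smul_mem _ _ (hφ j)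

theorem substV_mem_homogV {n d : ℕ} (A : Matrix (Fin n) (Fin n) ℝ)
    {φ : Fin n → MvPolynomial (Fin n) ℝ} (hφ : φ ∈ homogV n d) : substV A φ ∈ homogV n d := by
  rw [mem_homogV_iff] at *
  exact fun i => subst_mem_homogeneousSubmodule A (hφ i)

/-- An invertible `T` with inverse `T'` which preserves `H` and intertwines `A` and `A'` maps the
kernel of `A` in `H` onto that of `A'`. -/
theorem finrank_ker_inf_of_semiconjBy {W : Type*} [AddCommGroup W] [Module ℝ W]
    {T T' A A' : Module.End ℝ W} (hTT' : T * T' = 1) (hT'T : T' * T = 1) (hA : SemiconjBy T A A')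
    {H : Submodule ℝ W} (hT : ∀ w ∈ H, T w ∈ H) (hT' : ∀ w ∈ H, T' w ∈ H) :
    Module.finrank ℝ (LinearMap.ker A ⊓ H : Submodule ℝ W) =
      Module.finrank ℝ (LinearMap.ker A' ⊓ H : Submodule ℝ W) := by
  let e : W ≃ₗ[ℝ] W := LinearEquiv.ofLinearMap T T' hTT' hT'T
  have hA' : SemiconjBy T' A' A := by
    have : T' * (A' * T) * T' = T' * (T * A) * T' := by rw [hA.eq]
    rw [SemiconjBy]
    calc T' * A' = T' * (A' * T) * T' := by rw [mul_assoc, mul_assoc, hTT', mul_one]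
      _ = T' * T * A * T' := by rw [this, mul_assoc T' T A]
      _ = A * T' := by rw [hT'T, one_mul]
  suffices h : (LinearMap.ker A ⊓ H).map (e : W →ₗ[ℝ] W) = LinearMap.ker A' ⊓ H by
    rw [← h, LinearEquiv.finrank_map_eq e]
  ext w
  rw [Submodule.mem_map_equiv, Submodule.mem_inf, Submodule.mem_inf, LinearMap.mem_ker,
    LinearMap.mem_ker]
  change A (T' w) = 0 ∧ T' w ∈ H ↔ _
  have h1 : A (T' w) = T' (A' w) := (LinearMap.congr_fun hA'.eq w).symm
  have h2 : ∀ u, T (T' u) = u := LinearMap.congr_fun hTT'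
  rw [h1]
  refine and_congr ⟨fun h => ?_, fun h => by rw [h, map_zero]⟩ ⟨fun h => ?_, hT' w⟩
  · rw [← h2 (A' w), h, map_zero]
  · rw [← h2 w]
    exact hT _ h

variable {n : ℕ} (P : GL (Fin n) ℝ)

theorem semiconjBy_conj (A : Matrix (Fin n) (Fin n) ℝ) :
    SemiconjBy P.val ((P⁻¹).val * A * P.val) A := by
  rw [SemiconjBy, mul_assoc, ← mul_assoc, Units.mul_inv, one_mul]

theorem nilpotencyClass_conj (A : Matrix (Fin n) (Fin n) ℝ) :
    nilpotencyClass ((P⁻¹).val * A * P.val) = nilpotencyClass A := by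
  have : ∀ k, ((P⁻¹).val * A * P.val) ^ k = 0 ↔ A ^ k = 0 := by
    intro k
    rw [Units.conj_pow', Units.mul_left_eq_zero, Units.mul_right_eq_zero]
  simp only [nilpotencyClass, this]

theorem semiconjBy_multV_conj (A : Matrix (Fin n) (Fin n) ℝ) :
    SemiconjBy (multV P.val * substV (P⁻¹).val) (multV ((P⁻¹).val * A * P.val)) (multV A) := by
  have h : SemiconjBy (multV P.val) (multV ((P⁻¹).val * A * P.val)) (multV A) :=
    by simpa only [multVHom_apply] using (semiconjBy_conj P A).map (multVHom n)
  exact h.mul_left (multV_mul_substV _ _).symm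

theorem semiconjBy_substV_conj (A : Matrix (Fin n) (Fin n) ℝ) :
    SemiconjBy (multV P.val * substV (P⁻¹).val) (substV ((P⁻¹).val * A * P.val)) (substV A) := by
  refine SemiconjBy.mul_left (multV_mul_substV _ _) ?_
  rw [SemiconjBy, ← substV_mul, ← substV_mul, mul_assoc, Units.mul_inv, mul_one]

theorem finrank_ker_mulVecLin_of_semiconjBy {A A' : Matrix (Fin n) (Fin n) ℝ}
    (h : SemiconjBy P.val A A') :
    Module.finrank ℝ (LinearMap.ker A.mulVecLin) =
      Module.finrank ℝ (LinearMap.ker A'.mulVecLin) := by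
  have hmul : ∀ B B' : Matrix (Fin n) (Fin n) ℝ,
      (B.mulVecLin * B'.mulVecLin : Module.End ℝ (Fin n → ℝ)) = (B * B').mulVecLin :=
    fun B B' => (Matrix.mulVecLin_mul B B').symm
  have h2 := finrank_ker_inf_of_semiconjBy (H := ⊤) (T := P.val.mulVecLin)
    (T' := (P⁻¹).val.mulVecLin) (A := A.mulVecLin) (A' := A'.mulVecLin)
    (by rw [hmul, Units.mul_inv, Matrix.mulVecLin_one]; rfl)
    (by rw [hmul, Units.inv_mul, Matrix.mulVecLin_one]; rfl)
    (by rw [SemiconjBy, hmul, hmul, h.eq]) (fun _ _ => trivial) (fun _ _ => trivial)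
  rwa [inf_top_eq, inf_top_eq] at h2

theorem semiconjBy_deltaBarM_conj (N M : Matrix (Fin n) (Fin n) ℝ) :
    SemiconjBy (multV P.val * substV (P⁻¹).val)
      (deltaBarM ((P⁻¹).val * N * P.val) ((P⁻¹).val * M * P.val)) (deltaBarM N M) := by
  rw [deltaBarM, deltaBarM, nilpotencyClass_conj]
  exact (semiconjBy_barM _ (semiconjBy_multV_conj P N) (semiconjBy_multV_conj P M)).sub_right
    (semiconjBy_barM _ (semiconjBy_substV_conj P N) (semiconjBy_substV_conj P M))

theorem multV_mul_substV_mul_inverse {A B : Matrix (Fin n) (Fin n) ℝ} (h : A * B = 1) :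
    (multV A * substV B) * (multV B * substV A) = 1 := by
  rw [mul_assoc, ← mul_assoc (substV B), ← multV_mul_substV, mul_assoc (multV B), ← substV_mul, h,
    substV_one, mul_one, ← multVHom_apply, ← multVHom_apply, ← map_mul, h, map_one]

/-- Conjugate pairs have the same generating function: the change of coordinates
`φ ↦ P φ(P⁻¹ x)` preserves the degree and intertwines the two operators. -/
theorem kerGenFun_conj (N M : Matrix (Fin n) (Fin n) ℝ) :
    kerGenFun ((P⁻¹).val * N * P.val) ((P⁻¹).val * M * P.val) = kerGenFun N M := by
  have h1 := finrank_ker_mulVecLin_of_semiconjBy P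
    (semiconjBy_barM (nilpotencyClass ((P⁻¹).val * N * P.val)) (semiconjBy_conj P N)
      (semiconjBy_conj P M))
  conv_rhs at h1 => rw [nilpotencyClass_conj]
  have h2 := fun d => finrank_ker_inf_of_semiconjBy (H := homogV n d)
    (multV_mul_substV_mul_inverse (Units.mul_inv P))
    (multV_mul_substV_mul_inverse (Units.inv_mul P)) (semiconjBy_deltaBarM_conj P N M)
    (fun φ h => multV_mem_homogV _ (substV_mem_homogV _ h))
    (fun φ h => multV_mem_homogV _ (substV_mem_homogV _ h))
  simp only [kerGenFun, h1, h2]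

end Delta

/-! ### The generating function -/

section GeneratingFunction

theorem one_sub_X_mul_inv : (1 - PowerSeries.X : ℚ⟦X⟧) * (1 - PowerSeries.X)⁻¹ = 1 :=
  PowerSeries.mul_inv_cancel _ (by simp)

/-- The identity that makes the sum in the generating function telescope. -/
theorem X_mul_inv_one_sub_X_pow_succ (m : ℕ) :
    PowerSeries.X * ((1 - PowerSeries.X : ℚ⟦X⟧)⁻¹) ^ (m + 1) =
      ((1 - PowerSeries.X)⁻¹) ^ (m + 1) - ((1 - PowerSeries.X)⁻¹) ^ m := by
  linear_combination (-((1 - PowerSeries.X : ℚ⟦X⟧)⁻¹) ^ m) * one_sub_X_mul_inv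

theorem coeff_inv_one_sub_X_pow (n d : ℕ) :
    PowerSeries.coeff d (((1 - PowerSeries.X : ℚ⟦X⟧)⁻¹) ^ n) = n.multichoose d := by
  induction n generalizing d with
  | zero => cases d <;> simp [PowerSeries.coeff_one]
  | succ n ih =>
    induction d with
    | zero => simp
    | succ d ihd =>
      have h := congrArg (PowerSeries.coeff (d + 1)) (X_mul_inv_one_sub_X_pow_succ n)
      rw [PowerSeries.coeff_succ_X_mul, map_sub, ih, ihd] at h
      rw [Nat.multichoose_succ_succ]
      push_cast
      linarith

theorem sum_X_mul_inv_one_sub_X_pow (m : ℕ) :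
    ∑ i ∈ Finset.Icc 1 m, PowerSeries.X * ((1 - PowerSeries.X : ℚ⟦X⟧)⁻¹) ^ i =
      ((1 - PowerSeries.X)⁻¹) ^ m - 1 := by
  induction m with
  | zero => simp
  | succ m ih =>
    rw [Finset.sum_Icc_succ_top (by omega), ih, X_mul_inv_one_sub_X_pow_succ]
    ring

theorem kerGenFun_jordanTwo {k₁ k₂ : ℕ} (hk₁ : 1 ≤ k₁) (hk : k₁ ≤ k₂) :
    kerGenFun (jordanTwo k₁ k₂) (jordanTwo k₁ k₂).transpose =
      2 * ((1 - PowerSeries.X)⁻¹) ^ (k₁ + k₂) -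
        ∑ i ∈ Finset.Icc 1 (k₂ - k₁), PowerSeries.X * ((1 - PowerSeries.X)⁻¹) ^ i := by
  ext d
  rw [sum_X_mul_inv_one_sub_X_pow, ← map_ofNat (PowerSeries.C (R := ℚ)), map_sub, map_sub,
    PowerSeries.coeff_C_mul, coeff_inv_one_sub_X_pow, coeff_inv_one_sub_X_pow, kerGenFun,
    PowerSeries.coeff_mk, PowerSeries.coeff_one]
  split_ifs with hd
  · subst hd
    rw [finrank_ker_barM_jordanTwo hk₁ hk, Nat.multichoose_zero_right, Nat.multichoose_zero_right]
    norm_num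
  · rw [finrank_ker_deltaBarM hk₁ hk hd, sub_zero]

theorem conjecturedSeries_two {k₁ k₂ : ℕ} (hk : k₁ ≤ k₂) :
    conjecturedSeries ![k₁, k₂] =
      2 * ((1 - PowerSeries.X)⁻¹) ^ (k₁ + k₂) -
        ∑ i ∈ Finset.Icc 1 (k₂ - k₁), PowerSeries.X * ((1 - PowerSeries.X)⁻¹) ^ i := by
  rw [conjecturedSeries, Fin.sum_univ_two, Finset.sum_filter, Fintype.sum_prod_type,
    Fin.sum_univ_two, Fin.sum_univ_two, Fin.sum_univ_two]
  rcases hk.lt_or_eq with h | rfl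
  · simp [h, h.not_gt]
  · simp

end GeneratingFunction

/-! ### The summands as spans of monomials -/

section Summands

open MvPolynomial

/-- The numbers, counted from `1`, of the variables that occur in a monomial. -/
def varNums {n : ℕ} (α : Fin n →₀ ℕ) : Set ℕ := {j | ∃ i ∈ α.support, (i : ℕ) + 1 = j}

theorem mem_varNums_of_bounds {n : ℕ} {α : Fin n →₀ ℕ} {j : ℕ} (h : 1 ≤ j ∧ j ≤ n) :
    j ∈ varNums α ↔ (⟨j - 1, by omega⟩ : Fin n) ∈ α.support := by
  constructor
  · rintro ⟨i, hi, rfl⟩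
    exact hi
  · exact fun hj => ⟨_, hj, Nat.sub_add_cancel h.1⟩

theorem bounds_of_mem_varNums {n : ℕ} {α : Fin n →₀ ℕ} {j : ℕ} (h : j ∈ varNums α) :
    1 ≤ j ∧ j ≤ n := by
  obtain ⟨i, -, rfl⟩ := h
  have := i.2
  omega

theorem x_of_bounds {n j : ℕ} (h : 1 ≤ j ∧ j ≤ n) : x n j = X ⟨j - 1, by omega⟩ := by
  rw [x, dif_pos h]

theorem toSubmodule_supported_eq_restrictSupport {n : ℕ} (s : Set (Fin n)) :
    Subalgebra.toSubmodule (supported ℝ s) =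
      restrictSupport ℝ {α | ∀ i ∈ α.support, i ∈ s} := by
  ext q
  rw [Subalgebra.mem_toSubmodule, mem_supported, mem_restrictSupport_iff]
  simp only [Set.subset_def, Finset.mem_coe, mem_vars_iff_mem_support, Set.mem_ofPred_eq]
  exact ⟨fun h α hα i hi => h i ⟨α, hα, hi⟩, fun h i ⟨α, hα, hi⟩ => h α hα i hi⟩

/-- Multiplying the polynomials in the variables from `s` by a squarefree monomial in some of these
variables gives the span of the monomials in which the variables of this monomial occur. -/
theorem map_mulLeft_restrictSupport {n : ℕ} (t : Finset (Fin n)) {s : Set (Fin n)}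
    (hts : ∀ i ∈ t, i ∈ s) :
    (restrictSupport ℝ {α : Fin n →₀ ℕ | ∀ i ∈ α.support, i ∈ s}).map
        (LinearMap.mulLeft ℝ (∏ i ∈ t, X i)) =
      restrictSupport ℝ {α | t ⊆ α.support ∧ ∀ i ∈ α.support, i ∈ s} := by
  classical
  have hprod : (∏ i ∈ t, X i : MvPolynomial (Fin n) ℝ) =
      monomial (∑ i ∈ t, Finsupp.single i 1) 1 := by
    rw [monomial_sum_one]
    rfl
  have hγ : ∀ j, (∑ i ∈ t, Finsupp.single i 1 : Fin n →₀ ℕ) j = if j ∈ t then 1 else 0 := by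
    intro j
    rw [Finsupp.finsetSum_apply]
    simp [Finsupp.single_apply]
  set γ : Fin n →₀ ℕ := ∑ i ∈ t, Finsupp.single i 1
  rw [hprod, restrictSupport_eq_span, restrictSupport_eq_span, Submodule.map_span,
    ← Set.image_comp]
  congr 1
  ext q
  constructor
  · rintro ⟨α, hα, rfl⟩
    refine ⟨γ + α, ⟨fun j hj => ?_, fun j hj => ?_⟩, ?_⟩
    · rw [Finsupp.mem_support_iff, Finsupp.add_apply, hγ, if_pos hj]
      omega
    · by_cases hjt : j ∈ t
      · exact hts j hjt
      · rw [Finsupp.mem_support_iff, Finsupp.add_apply, hγ, if_neg hjt, zero_add] at hj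
        exact hα j (Finsupp.mem_support_iff.mpr hj)
    · simp [monomial_mul]
  · rintro ⟨β, ⟨htβ, hβ⟩, rfl⟩
    refine ⟨β - γ, fun j hj => hβ j ?_, ?_⟩
    · rw [Finsupp.mem_support_iff, Finsupp.tsub_apply] at hj
      rw [Finsupp.mem_support_iff]
      omega
    · have hle : γ ≤ β := fun j => by
        rw [hγ]
        split_ifs with hj
        · exact Nat.one_le_iff_ne_zero.mpr (Finsupp.mem_support_iff.mp (htβ hj))
        · exact Nat.zero_le _
      simp [monomial_mul, add_tsub_cancel_of_le hle]

theorem piece_prod_eq_restrictSupport {n a b c d : ℕ} (t : Finset (Fin n))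
    (ht : ∀ i ∈ t, (i : ℕ) + 1 ∈ Set.Icc a b ∨ (i : ℕ) + 1 ∈ Set.Icc c d) :
    piece n (∏ i ∈ t, X i) a b c d = restrictSupport ℝ
      {α | t ⊆ α.support ∧ ∀ j ∈ varNums α, j ∈ Set.Icc a b ∨ j ∈ Set.Icc c d} := by
  let s : Set (Fin n) := {i | (i : ℕ) + 1 ∈ Set.Icc a b ∨ (i : ℕ) + 1 ∈ Set.Icc c d}
  have hs : {g | ∃ j, (j ∈ Set.Icc a b ∨ j ∈ Set.Icc c d) ∧ j ∈ Set.Icc 1 n ∧ g = x n j} =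
      X '' s := by
    ext g
    constructor
    · rintro ⟨j, hj, hj1, rfl⟩
      have h1 : j - 1 + 1 = j := Nat.sub_add_cancel hj1.1
      refine ⟨⟨j - 1, by have := hj1.2; omega⟩, ?_, ?_⟩
      · change j - 1 + 1 ∈ _ ∨ j - 1 + 1 ∈ _
        rwa [h1]
      · exact (x_of_bounds hj1).symm
    · rintro ⟨i, hi, rfl⟩
      have hi1 : 1 ≤ (i : ℕ) + 1 ∧ (i : ℕ) + 1 ≤ n := ⟨by omega, i.2⟩
      exact ⟨i + 1, hi, hi1, (x_of_bounds hi1).symm⟩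
  rw [piece, hs, ← supported_eq_adjoin_X, toSubmodule_supported_eq_restrictSupport,
    map_mulLeft_restrictSupport (s := s) t ht]
  congr 1
  ext α
  refine and_congr_right fun _ => ⟨?_, fun h i hi => h _ ⟨i, hi, rfl⟩⟩
  rintro h _ ⟨i, hi, rfl⟩
  exact h i hi

theorem piece_x_eq_restrictSupport {n a b c d u : ℕ} (hu : 1 ≤ u ∧ u ≤ n)
    (hu' : u ∈ Set.Icc a b ∨ u ∈ Set.Icc c d) :
    piece n (x n u) a b c d = restrictSupport ℝ
      {α | u ∈ varNums α ∧ ∀ j ∈ varNums α, j ∈ Set.Icc a b ∨ j ∈ Set.Icc c d} := by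
  have h := piece_prod_eq_restrictSupport (n := n) (a := a) (b := b) (c := c) (d := d)
    {⟨u - 1, by omega⟩}
    (by simpa only [Finset.mem_singleton, forall_eq, Nat.sub_add_cancel hu.1] using hu')
  rw [Finset.prod_singleton] at h
  rw [x_of_bounds hu, h]
  simp only [mem_varNums_of_bounds hu, Finset.singleton_subset_iff]

theorem piece_x_mul_x_eq_restrictSupport {n a b c d u v : ℕ} (hu : 1 ≤ u ∧ u ≤ n)
    (hv : 1 ≤ v ∧ v ≤ n) (huv : u ≠ v) (hu' : u ∈ Set.Icc a b ∨ u ∈ Set.Icc c d)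
    (hv' : v ∈ Set.Icc a b ∨ v ∈ Set.Icc c d) :
    piece n (x n u * x n v) a b c d = restrictSupport ℝ
      {α | (u ∈ varNums α ∧ v ∈ varNums α) ∧
        ∀ j ∈ varNums α, j ∈ Set.Icc a b ∨ j ∈ Set.Icc c d} := by
  have h := piece_prod_eq_restrictSupport (n := n) (a := a) (b := b) (c := c) (d := d)
    {⟨u - 1, by omega⟩, ⟨v - 1, by omega⟩}
    (by
      simpa only [Finset.mem_insert, Finset.mem_singleton, forall_eq_or_imp, forall_eq,
        Nat.sub_add_cancel hu.1, Nat.sub_add_cancel hv.1] using ⟨hu', hv'⟩)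
  rw [Finset.prod_pair (by rw [Ne, Fin.mk.injEq]; omega)] at h
  rw [x_of_bounds hu, x_of_bounds hv, h]
  simp only [mem_varNums_of_bounds hu, mem_varNums_of_bounds hv, Finset.insert_subset_iff,
    Finset.singleton_subset_iff]

/-- `c.Contains V` says that the monomials whose variables have the numbers in `V` belong to the
summand with index `c`. -/
def PieceIdx.Contains {k₁ k₂ : ℕ} (V : Set ℕ) : PieceIdx k₁ k₂ → Prop
  | .A i _ => (1 ∈ V ∧ k₁ - i ∈ V) ∧
      ∀ j ∈ V, j ∈ Set.Icc 1 (k₁ - i) ∨ j ∈ Set.Icc (k₁ + 1) (k₁ + k₂ - i)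
  | .B i _ => (1 ∈ V ∧ k₁ + k₂ - i ∈ V) ∧
      ∀ j ∈ V, j ∈ Set.Icc 1 (k₁ - i - 1) ∨ j ∈ Set.Icc (k₁ + 1) (k₁ + k₂ - i)
  | .C => 1 ∈ V ∧ ∀ j ∈ V, j ∈ Set.Icc 1 1 ∨ j ∈ Set.Icc (k₁ + 1) (k₂ + 1)
  | .D i _ => (k₁ - i ∈ V ∧ k₁ + 1 ∈ V) ∧
      ∀ j ∈ V, j ∈ Set.Icc 2 (k₁ - i) ∨ j ∈ Set.Icc (k₁ + 1) (k₁ + k₂ - i)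
  | .E i _ => (k₁ + 1 ∈ V ∧ k₁ + k₂ - i ∈ V) ∧
      ∀ j ∈ V, j ∈ Set.Icc 2 (k₁ - i - 1) ∨ j ∈ Set.Icc (k₁ + 1) (k₁ + k₂ - i)
  | .F i _ _ => (k₁ + 1 ∈ V ∧ k₁ + k₂ - i ∈ V) ∧
      ∀ j ∈ V, j ∈ Set.Icc (k₁ + 1) (k₁ + k₂ - i) ∨ j ∈ Set.Icc (k₁ + 1) (k₁ + k₂ - i)
  | .G => k₁ + 1 ∈ V ∧
      ∀ j ∈ V, j ∈ Set.Icc (k₁ + 1) (k₁ + 1) ∨ j ∈ Set.Icc (k₁ + 1) (k₁ + 1)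

variable {k₁ k₂ : ℕ}

theorem summand_eq_restrictSupport (hk₁ : 1 ≤ k₁) (hk : k₁ ≤ k₂) (c : PieceIdx k₁ k₂) :
    summand k₁ k₂ c = restrictSupport ℝ {α | c.Contains (varNums α)} := by
  cases c with
  | C => exact piece_x_eq_restrictSupport (by omega) (by simp only [Set.mem_Icc]; omega)
  | G => exact piece_x_eq_restrictSupport (by omega) (by simp only [Set.mem_Icc]; omega)
  | _ =>
    exact piece_x_mul_x_eq_restrictSupport (by omega) (by omega) (by omega)
      (by simp only [Set.mem_Icc]; omega) (by simp only [Set.mem_Icc]; omega)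

/-! ### Classification of the monomials by the summands -/

theorem PieceIdx.Contains.one_mem_or {c : PieceIdx k₁ k₂} {V : Set ℕ} (h : c.Contains V) :
    1 ∈ V ∨ k₁ + 1 ∈ V := by
  cases c <;> simp only [PieceIdx.Contains] at h <;> tauto

/-- The number of positions after the variable number `j` in its block, numbering from `1`. -/
def room (k₁ k₂ j : ℕ) : ℕ := if j ≤ k₁ then k₁ - j else k₁ + k₂ - j

theorem PieceIdx.Contains.weight_le_room (hk₁ : 1 ≤ k₁) (hk : k₁ ≤ k₂) {c : PieceIdx k₁ k₂}
    {V : Set ℕ} (h : c.Contains V) {j : ℕ} (hj : j ∈ V) : weight k₁ k₂ c ≤ room k₁ k₂ j := by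
  cases c
  all_goals
    simp only [PieceIdx.Contains] at h
    have := h.2 j hj
    simp only [Set.mem_Icc, weight, room] at *
    split_ifs <;> omega

theorem PieceIdx.Contains.exists_room_eq_weight (hk₁ : 1 ≤ k₁) (hk : k₁ ≤ k₂)
    {c : PieceIdx k₁ k₂} {V : Set ℕ} (h : c.Contains V) :
    ∃ j ∈ V, room k₁ k₂ j = weight k₁ k₂ c := by
  cases c with
  | A => exact ⟨_, h.1.2, by simp only [room, weight]; split_ifs <;> omega⟩
  | B => exact ⟨_, h.1.2, by simp only [room, weight]; split_ifs <;> omega⟩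
  | C => exact ⟨_, h.1, by simp only [room, weight]; split_ifs; omega⟩
  | D => exact ⟨_, h.1.1, by simp only [room, weight]; split_ifs <;> omega⟩
  | E => exact ⟨_, h.1.2, by simp only [room, weight]; split_ifs <;> omega⟩
  | F => exact ⟨_, h.1.2, by simp only [room, weight]; split_ifs <;> omega⟩
  | G => exact ⟨_, h.1, by simp only [room, weight]; split_ifs <;> omega⟩

/-- The summand containing a monomial is unique: its weight, the least room of the variables of the
monomial, determines the index `i`, and the type is read off from `i` and from the presence of the
variables `x₁` and `x_{k₁ - i}`. -/
theorem PieceIdx.Contains.unique (hk₁ : 1 ≤ k₁) (hk : k₁ ≤ k₂) {c c' : PieceIdx k₁ k₂} {V : Set ℕ}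
    (h : c.Contains V) (h' : c'.Contains V) : c = c' := by
  have hw : weight k₁ k₂ c = weight k₁ k₂ c' := by
    obtain ⟨j, hj, hr⟩ := h.exists_room_eq_weight hk₁ hk
    obtain ⟨j', hj', hr'⟩ := h'.exists_room_eq_weight hk₁ hk
    have := h.weight_le_room hk₁ hk hj'
    have := h'.weight_le_room hk₁ hk hj
    omega
  cases c <;> cases c' <;> simp only [weight] at hw <;> try subst hw
  all_goals first
    | rfl
    | exfalso
      simp only [PieceIdx.Contains, Set.mem_Icc] at h h'
      grind

theorem PieceIdx.exists_contains (hk₁ : 1 ≤ k₁) (hk : k₁ ≤ k₂) {V : Set ℕ}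
    (hV : ∀ j ∈ V, 1 ≤ j ∧ j ≤ k₁ + k₂) (h : 1 ∈ V ∨ k₁ + 1 ∈ V) :
    ∃ c : PieceIdx k₁ k₂, c.Contains V := by
  -- `j₀` is a variable with the least number of positions after it, and `i` is this number
  obtain ⟨j₀, hj₀, hmin⟩ : ∃ j₀ ∈ V, ∀ j ∈ V, room k₁ k₂ j₀ ≤ room k₁ k₂ j := by
    have hne : V.Nonempty := h.elim (fun h => ⟨_, h⟩) (fun h => ⟨_, h⟩)
    obtain ⟨j₀, hj₀⟩ := exists_minimalFor_of_wellFoundedLT (· ∈ V) (room k₁ k₂) hne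
    exact ⟨j₀, hj₀.1, fun j hj => (le_total _ _).elim id fun hle => hj₀.2 hj hle⟩
  obtain ⟨i, hi⟩ : ∃ i, i = room k₁ k₂ j₀ := ⟨_, rfl⟩
  rw [← hi] at hmin
  have hjV := hV j₀ hj₀
  have hroom : j₀ = k₁ - i ∧ i < k₁ ∨ j₀ = k₁ + k₂ - i ∧ i < k₂ := by
    simp only [room] at hi
    split_ifs at hi <;> omega
  have hrange : ∀ j ∈ V, (1 ≤ j ∧ j ≤ k₁ ∧ j + i ≤ k₁) ∨ (k₁ + 1 ≤ j ∧ j + i ≤ k₁ + k₂) := by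
    intro j hj
    have h1 := hmin j hj
    have h2 := hV j hj
    simp only [room] at h1
    split_ifs at h1 <;> omega
  by_cases h1 : 1 ∈ V
  · have := hrange 1 h1
    by_cases hi1 : i + 2 ≤ k₁
    · by_cases h2 : k₁ - i ∈ V
      · refine ⟨.A i hi1, ⟨h1, h2⟩, fun j hj => ?_⟩
        have := hrange j hj
        simp only [Set.mem_Icc]
        omega
      · have h3 : k₁ + k₂ - i ∈ V := by grind
        refine ⟨.B i hi1, ⟨h1, h3⟩, fun j hj => ?_⟩
        have := hrange j hj
        have : j ≠ k₁ - i := fun h => h2 (h ▸ hj)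
        simp only [Set.mem_Icc]
        omega
    · refine ⟨.C, h1, fun j hj => ?_⟩
      have := hrange j hj
      simp only [Set.mem_Icc]
      omega
  · have h2 : k₁ + 1 ∈ V := h.resolve_left h1
    have hne1 : ∀ j ∈ V, j ≠ 1 := fun j hj h => h1 (h ▸ hj)
    by_cases hi2 : i + 2 ≤ k₂
    · by_cases h3 : i + 2 ≤ k₁ ∧ k₁ - i ∈ V
      · refine ⟨.D i h3.1, ⟨h3.2, h2⟩, fun j hj => ?_⟩
        have := hrange j hj
        have := hne1 j hj
        simp only [Set.mem_Icc]
        omega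
      · have h4 : k₁ + k₂ - i ∈ V := by grind
        by_cases hi3 : i + 3 ≤ k₁
        · refine ⟨.E i hi3, ⟨h2, h4⟩, fun j hj => ?_⟩
          have := hrange j hj
          have := hne1 j hj
          have : j ≠ k₁ - i := fun h => h3 ⟨by omega, h ▸ hj⟩
          simp only [Set.mem_Icc]
          omega
        · refine ⟨.F i (by omega) hi2, ⟨h2, h4⟩, fun j hj => ?_⟩
          have := hrange j hj
          have := hne1 j hj
          have : i + 2 ≤ k₁ → j ≠ k₁ - i := fun hi h => h3 ⟨hi, h ▸ hj⟩
          simp only [Set.mem_Icc]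
          omega
    · refine ⟨.G, h2, fun j hj => ?_⟩
      have := hrange j hj
      have := hne1 j hj
      simp only [Set.mem_Icc]
      omega

/-! ### The decomposition of the kernel of `S_{M̄}` -/

theorem iSup_restrictSupport {n : ℕ} {κ : Type*} (S : κ → Set (Fin n →₀ ℕ)) :
    ⨆ c, restrictSupport ℝ (S c) = restrictSupport ℝ (⋃ c, S c) := by
  simp only [restrictSupport_eq_span, Set.image_iUnion, Submodule.span_iUnion]

theorem iSupIndep_restrictSupport {n : ℕ} {κ : Type*} {S : κ → Set (Fin n →₀ ℕ)}
    (hS : ∀ c c' α, α ∈ S c → α ∈ S c' → c = c') : iSupIndep fun c => restrictSupport ℝ (S c) := by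
  intro c
  rw [Submodule.disjoint_def]
  intro q hq hq'
  have hle : ⨆ c', ⨆ _ : c' ≠ c, restrictSupport ℝ (S c') ≤
      restrictSupport ℝ (⋃ c', ⋃ _ : c' ≠ c, S c') :=
    iSup₂_le fun c' h => restrictSupport_mono ℝ (Set.subset_iUnion₂ (s := fun c' _ => S c') c' h)
  by_contra hne
  obtain ⟨α, hα⟩ := support_nonempty.mpr hne
  obtain ⟨c', hc'⟩ := Set.mem_iUnion.mp (hle hq' hα)
  obtain ⟨hcc', hα'⟩ := Set.mem_iUnion.mp hc'
  exact hcc' (hS _ _ α hα' (hq hα))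

theorem noConst_eq_restrictSupport (n : ℕ) :
    noConst n = restrictSupport ℝ {α : Fin n →₀ ℕ | α ≠ 0} := by
  ext q
  rw [noConst, LinearMap.mem_ker, mem_restrictSupport_iff, lcoeff_apply]
  simp only [Set.subset_def, Finset.mem_coe, mem_support_iff, Set.mem_ofPred_eq]
  exact ⟨fun h α hα h0 => hα (h0 ▸ h), fun h => not_not.mp fun h0 => h 0 h0 rfl⟩

theorem iSupIndep_summand (hk₁ : 1 ≤ k₁) (hk : k₁ ≤ k₂) : iSupIndep (summand k₁ k₂) := by
  rw [funext (summand_eq_restrictSupport hk₁ hk)]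
  exact iSupIndep_restrictSupport fun c c' α h h' => h.unique hk₁ hk h'

theorem iSup_summand (hk₁ : 1 ≤ k₁) (hk : k₁ ≤ k₂) :
    ⨆ c, summand k₁ k₂ c =
      LinearMap.ker (substBarM (jordanTwo k₁ k₂) (jordanTwo k₁ k₂).transpose) ⊓
        noConst (k₁ + k₂) := by
  have h := ker_substBarM_pow_inf_restrictSupport hk₁ hk 1
    (S := {α : Fin (k₁ + k₂) →₀ ℕ | α ≠ 0}) (by simp)
  rw [pow_one] at h
  rw [noConst_eq_restrictSupport, h, funext (summand_eq_restrictSupport hk₁ hk),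
    iSup_restrictSupport]
  congr 1
  ext α
  rw [Set.mem_iUnion]
  constructor
  · rintro ⟨c, hc⟩
    have hstart : ∃ i ∈ α.support, lo i < 1 := by
      rcases PieceIdx.Contains.one_mem_or hc with ⟨i, hi, h⟩ | ⟨i, hi, h⟩ <;>
      · refine ⟨i, hi, ?_⟩
        simp only [lo]
        split_ifs <;> omega
    refine ⟨?_, hstart⟩
    obtain ⟨i, hi, -⟩ := hstart
    exact Finsupp.support_nonempty_iff.mp ⟨i, hi⟩
  · rintro ⟨-, i, hi, hlo⟩
    refine PieceIdx.exists_contains hk₁ hk (fun j => bounds_of_mem_varNums) ?_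
    simp only [lo] at hlo
    split_ifs at hlo
    · exact Or.inl ⟨i, hi, by omega⟩
    · exact Or.inr ⟨i, hi, by omega⟩

theorem summand_le_eigenspace (hk₁ : 1 ≤ k₁) (hk : k₁ ≤ k₂) (c : PieceIdx k₁ k₂) :
    summand k₁ k₂ c ≤ Module.End.eigenspace
      (substBarH (jordanTwo k₁ k₂) (jordanTwo k₁ k₂).transpose) (weight k₁ k₂ c : ℝ) := by
  rw [summand_eq_restrictSupport hk₁ hk, restrictSupport_eq_span, Submodule.span_le]
  rintro _ ⟨α, hc, rfl⟩
  have hroom : ∀ i : Fin (k₁ + k₂), room k₁ k₂ (i + 1) = hi i := by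
    intro i
    simp only [room, hi]
    split_ifs <;> omega
  have hne : α ≠ 0 := by
    rcases PieceIdx.Contains.one_mem_or hc with ⟨i, hi, -⟩ | ⟨i, hi, -⟩ <;>
    exact Finsupp.support_nonempty_iff.mp ⟨i, hi⟩
  let α' : NonzeroExp (k₁ + k₂) := ⟨α, hne⟩
  have hlo : minOn lo α' = 0 := by
    by_contra h
    rcases PieceIdx.Contains.one_mem_or hc with ⟨i, hi, h1⟩ | ⟨i, hi, h1⟩ <;>
    · have := le_minOn_iff.mp (Nat.one_le_iff_ne_zero.mpr h) i hi
      simp only [lo] at this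
      split_ifs at this <;> omega
  have hhi : minOn hi α' = weight k₁ k₂ c := by
    apply le_antisymm
    · obtain ⟨_, ⟨i, hi, rfl⟩, h⟩ := PieceIdx.Contains.exists_room_eq_weight hk₁ hk hc
      rw [← h, hroom]
      exact le_minOn_iff.mp le_rfl i hi
    · refine le_minOn_iff.mpr fun i hi => ?_
      rw [← hroom]
      exact PieceIdx.Contains.weight_le_room hk₁ hk hc ⟨i, hi, rfl⟩
  rw [SetLike.mem_coe, Module.End.mem_eigenspace_iff, ← hhi]
  exact isShiftPair_subst.barH_apply (i := α')
    ((minOn_hi_add_minOn_lo_le hk α').trans (le_nilpotencyClass hk₁ hk)) hlo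

end Summands

end NilpotentMap

end

theorem mainTheorem7 (k₁ k₂ : ℕ) (hk₁ : 1 ≤ k₁) (hk : k₁ ≤ k₂) :
    -- the decomposition of `ker S_{M̄}` for the Jordan form, with its `S_{H̄}`-eigenvalues
    (iSupIndep (NilpotentMap.summand k₁ k₂) ∧
      (⨆ c, NilpotentMap.summand k₁ k₂ c) =
        LinearMap.ker (NilpotentMap.substBarM (NilpotentMap.jordanTwo k₁ k₂)
          (NilpotentMap.jordanTwo k₁ k₂).transpose) ⊓ NilpotentMap.noConst (k₁ + k₂) ∧
      ∀ c, NilpotentMap.summand k₁ k₂ c ≤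
        Module.End.eigenspace (NilpotentMap.substBarH (NilpotentMap.jordanTwo k₁ k₂)
          (NilpotentMap.jordanTwo k₁ k₂).transpose) (NilpotentMap.weight k₁ k₂ c : ℝ)) ∧
    -- the generating function of `ker Δ_{M̄}`, for every nilpotent with this Jordan form
    (∀ P : GL (Fin (k₁ + k₂)) ℝ,
      NilpotentMap.kerGenFun
          ((P⁻¹).val * NilpotentMap.jordanTwo k₁ k₂ * P.val)
          ((P⁻¹).val * (NilpotentMap.jordanTwo k₁ k₂).transpose * P.val) =
        2 * ((1 - PowerSeries.X)⁻¹) ^ (k₁ + k₂) -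
          ∑ i ∈ Finset.Icc 1 (k₂ - k₁), PowerSeries.X * ((1 - PowerSeries.X)⁻¹) ^ i) ∧
    -- which is the series conjectured for blocks of sizes `k₁, k₂`
    (∀ P : GL (Fin (k₁ + k₂)) ℝ,
      NilpotentMap.kerGenFun
          ((P⁻¹).val * NilpotentMap.jordanTwo k₁ k₂ * P.val)
          ((P⁻¹).val * (NilpotentMap.jordanTwo k₁ k₂).transpose * P.val) =
        NilpotentMap.conjecturedSeries ![k₁, k₂]) := by
  have hgen := fun P : GL (Fin (k₁ + k₂)) ℝ =>
    (NilpotentMap.kerGenFun_conj P (NilpotentMap.jordanTwo k₁ k₂)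
      (NilpotentMap.jordanTwo k₁ k₂).transpose).trans (NilpotentMap.kerGenFun_jordanTwo hk₁ hk)
  exact ⟨⟨NilpotentMap.iSupIndep_summand hk₁ hk, NilpotentMap.iSup_summand hk₁ hk,
    NilpotentMap.summand_le_eigenspace hk₁ hk⟩, hgen,
    fun P => (hgen P).trans (NilpotentMap.conjecturedSeries_two hk).symm⟩
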